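/- **Setting.** There are $K\ge 2$ arms and $T>K$ rounds; $\lambda$ is the switching cost. In round $t$ the environment produces a loss vector $\ell_t\in[0,1]^K$, the learner plays an arm $I_t$, drawn independently of $\ell_t$ given the past, and observes only $\ell_{t,I_t}$. Put $S_T=\sum_{t=1}^T \mathbf 1\{I_t\ne I_{t-1}\}$, where $I_0\notin[K]$, so that the first play counts as a switch. The pseudo-regret with switching cost is $$\overline{\mathcal R}_T^\lambda=\sum_{t=1}^T \ell_{t,I_t}-\min_{i\in[K]}\sum_{t=1}^T\mathbb E[\ell_{t,i}]+\lambda S_T .$$ **Algorithm ("Switch Tsallis, Switch!").** Tsallis-INF samples its $n$-th arm $I$ from $$p_n=\operatorname*{arg\,min}_{p\in\Delta^K}\Big\{\Big(\sum_{r<n}\hat\ell_r\Big)\cdot p-\frac1{\eta_n}\sum_{i\in[K]}4\sqrt{p_i}\Big\},\qquad \eta_n=\frac{2}{\sqrt n},$$ and, after observing a loss $x$, sets $\hat\ell_{n,i}=\frac{x}{p_{n,i}}\mathbf 1\{I=i\}$. *First phase:* Tsallis-INF is run with one round per sample ($x=\ell_{t,I_t}$) until the end of the first round at which the number of switches so far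 is at least $K^{1/3}(T/\lambda)^{2/3}$. *Second phase:* in the remaining rounds, if any, Tsallis-INF is restarted afresh on consecutive blocks of $B=\lceil\lambda^{2/3}K^{-1/3}T^{1/3}\rceil$ rounds (the last block is cut off at round $T$): one arm is sampled per block and played throughout it, and $x$ is the average of its losses over the block. **Environments.** In the *oblivious adversarial regime* $\ell_1,\dots,\ell_T\in[0,1]^K$ are arbitrary and fixed in advance. In the *stochastically constrained regime* the conditional law of $\ell_t$ given all earlier losses and arms is arbitrary (it may change with $t$ and depend on the past), except that there are an arm $i^\star$ and gaps $\Delta_i>0$ ($i\ne i^\star$) such that, for every $t$ and every past, $$\mathbb E[\ell_{t,i}-\ell_{t,i^\star}\mid \text{past}]=\Delta_i\qquad(i\neq i^\star),$$ and that, if $t$ lies in a block of the second phase, this conditional law does not depend on the arm sampled for that block. Let $\Delta_{\min}=\min_{i\ne i^\star}\Delta_i$. **Theorem.** There is a universal constant $C>0$ such that for all $K\ge2$, all $T>K$ and all $\lambda$ with $\sqrt{K/T}\le\lambda\le\sqrt K\,T$, the algorithm "Switch Tsallis, Switch!" satisfies the following simultaneously: * for every environment of the oblivious adversarial regime, $$\mathbb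 E\big[\overline{\mathcal R}_T^\lambda\big]\le C\,(\lambda K)^{1/3}T^{2/3};$$ * for every environment of the stochastically constrained regime, $$\mathbb E\big[\overline{\mathcal R}_T^\lambda\big]\le C\,\min\Big\{\Big(\frac{\lambda\log T}{\Delta_{\min}}+\log T\Big)\sum_{i\ne i^\star}\frac1{\Delta_i},\;(\lambda K)^{1/3}T^{2/3}\Big\}.$$ -/

import Mathlib

open MeasureTheory ProbabilityTheory

namespace SwitchTsallis

/-! ### The Tsallis-INF distribution -/

/-- The objective `∑ᵢ Lᵢ pᵢ - (1/η) ∑ᵢ 4 √pᵢ` minimised over the simplex by Tsallis-INF. -/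
noncomputable def tsallisObjective {K : ℕ} (L : Fin K → ℝ) (η : ℝ) (p : Fin K → ℝ) : ℝ :=
  ∑ i, L i * p i - (1 / η) * ∑ i, 4 * √(p i)

theorem continuous_tsallisObjective {K : ℕ} (η : ℝ) :
    Continuous fun x : (Fin K → ℝ) × (Fin K → ℝ) => tsallisObjective x.1 η x.2 := by
  unfold tsallisObjective
  fun_prop

theorem exists_isMinOn_tsallisObjective {K : ℕ} [NeZero K] (L : Fin K → ℝ) (η : ℝ) :
    ∃ p ∈ stdSimplex ℝ (Fin K), IsMinOn (tsallisObjective L η) (stdSimplex ℝ (Fin K)) p := by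
  refine (isCompact_stdSimplex ℝ (Fin K)).exists_isMinOn ⟨_, single_mem_stdSimplex ℝ 0⟩ ?_
  exact ((continuous_tsallisObjective η).comp
    (continuous_const.prodMk continuous_id)).continuousOn

/-- `argmin_{p ∈ Δ^K} { L · p - (1/η) ∑ᵢ 4 √pᵢ }`. The minimiser is unique when `η > 0`. -/
noncomputable def tsallisWeights {K : ℕ} [NeZero K] (L : Fin K → ℝ) (η : ℝ) : Fin K → ℝ :=
  Classical.choose (exists_isMinOn_tsallisObjective L η)

theorem tsallisWeights_mem {K : ℕ} [NeZero K] (L : Fin K → ℝ) (η : ℝ) :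
    tsallisWeights L η ∈ stdSimplex ℝ (Fin K) :=
  (Classical.choose_spec (exists_isMinOn_tsallisObjective L η)).1

theorem tsallisWeights_isMinOn {K : ℕ} [NeZero K] (L : Fin K → ℝ) (η : ℝ) :
    IsMinOn (tsallisObjective L η) (stdSimplex ℝ (Fin K)) (tsallisWeights L η) :=
  (Classical.choose_spec (exists_isMinOn_tsallisObjective L η)).2

theorem eq_tsallisWeights {K : ℕ} [NeZero K] {L : Fin K → ℝ} {η : ℝ} (hη : 0 < η)
    {p : Fin K → ℝ} (hp : p ∈ stdSimplex ℝ (Fin K))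
    (hmin : IsMinOn (tsallisObjective L η) (stdSimplex ℝ (Fin K)) p) :
    p = tsallisWeights L η := by
  set q := tsallisWeights L η with hq
  have hqm := tsallisWeights_mem L η
  rw [← hq] at hqm
  by_contra hne
  obtain ⟨j, hj⟩ := Function.ne_iff.mp hne
  have hmid : (1 / 2 : ℝ) • p + (1 / 2 : ℝ) • q ∈ stdSimplex ℝ (Fin K) :=
    convex_stdSimplex ℝ (Fin K) hp hqm (by norm_num) (by norm_num) (by norm_num)
  have h1 : tsallisObjective L η p ≤ _ := hmin hmid
  have h2 : tsallisObjective L η q ≤ _ := tsallisWeights_isMinOn L η hmid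
  have hs : ∑ i, 4 * √(((1 / 2 : ℝ) • p + (1 / 2 : ℝ) • q) i)
      > ∑ i, ((1 / 2) * (4 * √(p i)) + (1 / 2) * (4 * √(q i))) := by
    apply Finset.sum_lt_sum
    · intro i _
      have := Real.strictConcaveOn_sqrt.concaveOn.2 (hp.1 i) (hqm.1 i)
        (by norm_num : (0 : ℝ) ≤ 1 / 2) (by norm_num : (0 : ℝ) ≤ 1 / 2) (by norm_num)
      simp only [smul_eq_mul, Pi.add_apply, Pi.smul_apply] at this ⊢
      linarith
    · refine ⟨j, Finset.mem_univ j, ?_⟩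
      have := Real.strictConcaveOn_sqrt.2 (hp.1 j) (hqm.1 j) hj
        (by norm_num : (0 : ℝ) < 1 / 2) (by norm_num : (0 : ℝ) < 1 / 2) (by norm_num)
      simp only [smul_eq_mul, Pi.add_apply, Pi.smul_apply] at this ⊢
      linarith
  have hl : ∑ i, L i * ((1 / 2 : ℝ) • p + (1 / 2 : ℝ) • q) i
      = (1 / 2) * ∑ i, L i * p i + (1 / 2) * ∑ i, L i * q i := by
    rw [Finset.mul_sum, Finset.mul_sum, ← Finset.sum_add_distrib]
    refine Finset.sum_congr rfl fun i _ => ?_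
    simp only [smul_eq_mul, Pi.add_apply, Pi.smul_apply]
    ring
  rw [Finset.sum_add_distrib, ← Finset.mul_sum (s := Finset.univ) (a := (1 / 2 : ℝ)),
    ← Finset.mul_sum (s := Finset.univ) (a := (1 / 2 : ℝ))] at hs
  have hs' := mul_lt_mul_of_pos_left hs (one_div_pos.mpr hη)
  unfold tsallisObjective at h1 h2
  rw [hl] at h1 h2
  nlinarith

theorem measurable_tsallisWeights {K : ℕ} [NeZero K] {η : ℝ} (hη : 0 < η) :
    Measurable fun L : Fin K → ℝ => tsallisWeights L η := by
  refine measurable_of_isClosed fun F hF => ?_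
  have hA : IsClosed {x : (Fin K → ℝ) × {p // p ∈ stdSimplex ℝ (Fin K)} | x.2.1 ∈ F} :=
    hF.preimage (continuous_subtype_val.comp continuous_snd)
  have hB : IsClosed (⋂ q : {p // p ∈ stdSimplex ℝ (Fin K)},
      {x : (Fin K → ℝ) × {p // p ∈ stdSimplex ℝ (Fin K)} |
        tsallisObjective x.1 η x.2.1 ≤ tsallisObjective x.1 η q.1}) := by
    refine isClosed_iInter fun q => isClosed_le ?_ ?_
    · exact (continuous_tsallisObjective η).comp
        (continuous_fst.prodMk (continuous_subtype_val.comp continuous_snd))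
    · exact (continuous_tsallisObjective η).comp (continuous_fst.prodMk continuous_const)
  have : CompactSpace {p // p ∈ stdSimplex ℝ (Fin K)} :=
    isCompact_iff_compactSpace.mp (isCompact_stdSimplex ℝ (Fin K))
  have hI := isClosedMap_fst_of_compactSpace _ (hA.inter hB)
  convert hI.measurableSet using 1
  ext L
  constructor
  · intro h
    exact ⟨(L, ⟨_, tsallisWeights_mem L η⟩),
      ⟨h, Set.mem_iInter.mpr fun q => tsallisWeights_isMinOn L η q.2⟩, rfl⟩
  · rintro ⟨⟨L', p⟩, ⟨h1, h2⟩, rfl⟩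
    have h3 : p.1 = tsallisWeights L' η :=
      eq_tsallisWeights hη p.2 (fun q hq => Set.mem_iInter.mp h2 ⟨q, hq⟩)
    change tsallisWeights L' η ∈ F
    rw [← h3]
    exact h1

/-! ### Losses, histories and the learner -/

/-- A loss vector in `[0,1]^K`. -/
abbrev Loss (K : ℕ) : Type := Fin K → unitInterval

/-- What happens in one round: the arm played and the loss vector. -/
abbrev Step (K : ℕ) : Type := Fin K × Loss K

/-- The first `t` rounds of a game. Rounds are numbered `0, 1, …, t - 1`. -/
abbrev History (K t : ℕ) : Type := Fin t → Step K

/-- The discrete part of the memory of the learner. -/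
@[ext]
structure Control (K : ℕ) where
  /-- whether the algorithm is in its second phase -/
  inBlocks : Bool
  /-- number of loss estimates made in the current phase -/
  updates : ℕ
  /-- number of switches so far -/
  switches : ℕ
  /-- the arm played in the previous round, `none` before the first round -/
  last : Option (Fin K)
  /-- number of rounds of the current block already played (`0` in the first phase) -/
  pos : ℕ

instance (K : ℕ) : MeasurableSpace (Control K) := ⊤

instance (K : ℕ) : DiscreteMeasurableSpace (Control K) := ⟨fun _ => trivial⟩

instance (K : ℕ) : Countable (Control K) :=
  Function.Injective.countable
    (f := fun c : Control K => (c.inBlocks, c.updates, c.switches, c.last, c.pos))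
    (by rintro ⟨⟩ ⟨⟩ h; simpa using h)

/-- The memory of the learner: the discrete part, the sum of the loss estimates of the current
phase, and the loss accumulated in the current block. -/
abbrev State (K : ℕ) : Type := Control K × (Fin K → ℝ) × ℝ

/-- The memory of the learner before the first round. -/
def initState (K : ℕ) : State K := (⟨false, 0, 0, none, 0⟩, 0, 0)

/-- The switching threshold `K^{1/3} (T/λ)^{2/3}`. -/
noncomputable def switchThreshold (K T : ℕ) (lam : ℝ) : ℝ :=
  (K : ℝ) ^ (1 / 3 : ℝ) * ((T : ℝ) / lam) ^ (2 / 3 : ℝ)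

/-- The block size `⌈λ^{2/3} K^{-1/3} T^{1/3}⌉`. -/
noncomputable def blockSize (K T : ℕ) (lam : ℝ) : ℕ :=
  ⌈lam ^ (2 / 3 : ℝ) * (K : ℝ) ^ (-(1 / 3) : ℝ) * (T : ℝ) ^ (1 / 3 : ℝ)⌉₊

/-- The Tsallis-INF distribution of the current state. The `n`-th distribution of a phase,
`n = updates + 1`, has the learning rate `2 / √n`. -/
noncomputable def stateWeights {K : ℕ} [NeZero K] (s : State K) : Fin K → ℝ :=
  tsallisWeights s.2.1 (2 / √((s.1.updates : ℝ) + 1))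

/-- The distribution of the next arm: inside a block the arm of the block is repeated, otherwise
the arm is sampled from the Tsallis-INF distribution. -/
noncomputable def armProb {K : ℕ} [NeZero K] (s : State K) : Fin K → ℝ :=
  match s.1.pos, s.1.last with
  | _ + 1, some i => Pi.single i 1
  | _, _ => stateWeights s

/-- Increment of the importance-weighted loss estimate: `(x / pᵢ) 1{I = i}`. -/
noncomputable def estimate {K : ℕ} [NeZero K] (s : State K) (i : Fin K) (x : ℝ) : Fin K → ℝ :=
  Pi.single i (x / stateWeights s i)

/-- The update of the memory after playing arm `i` and observing its loss `x`.
First phase: update the estimates and the number of switches, and move to the second phase, with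
fresh estimates, once the number of switches has reached the threshold.
Second phase: accumulate the loss, and update the estimates with the average loss at the end of
the block. -/
noncomputable def nextState {K : ℕ} [NeZero K] (T : ℕ) (lam : ℝ) (s : State K) (i : Fin K)
    (x : ℝ) : State K :=
  let S : ℕ := s.1.switches + if s.1.last = some i then 0 else 1
  if s.1.inBlocks = false then
    if switchThreshold K T lam ≤ S then (⟨true, 0, S, some i, 0⟩, 0, 0)
    else (⟨false, s.1.updates + 1, S, some i, 0⟩, s.2.1 + estimate s i x, 0)
  else
    if blockSize K T lam ≤ s.1.pos + 1 then
      (⟨true, s.1.updates + 1, S, some i, 0⟩,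
        s.2.1 + estimate s i ((s.2.2 + x) / blockSize K T lam), 0)
    else (⟨true, s.1.updates, S, some i, s.1.pos + 1⟩, s.2.1, s.2.2 + x)

/-- The memory of the learner after the rounds in `h`. Only the losses of the arms that were
played are used. -/
noncomputable def run {K : ℕ} [NeZero K] (T : ℕ) (lam : ℝ) :
    (t : ℕ) → History K t → State K
  | 0, _ => initState K
  | t + 1, h => nextState T lam (run T lam t (Fin.init h)) (h (Fin.last t)).1
      ((h (Fin.last t)).2 (h (Fin.last t)).1)

theorem measurable_stateWeights {K : ℕ} [NeZero K] :
    Measurable (stateWeights : State K → Fin K → ℝ) := by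
  refine measurable_from_prod_countable_right fun c => ?_
  have hη : 0 < 2 / √((c.updates : ℝ) + 1) := by positivity
  exact (measurable_tsallisWeights hη).comp measurable_fst

theorem measurable_armProb {K : ℕ} [NeZero K] :
    Measurable (armProb : State K → Fin K → ℝ) := by
  refine measurable_from_prod_countable_right fun c => ?_
  obtain ⟨b, u, S, l, q⟩ := c
  have h := (measurable_stateWeights (K := K)).comp
    (measurable_prodMk_left (x := (⟨b, u, S, l, q⟩ : Control K)))
  cases q with
  | zero => exact h
  | succ q =>
    cases l with
    | none => exact h
    | some i => exact measurable_const

theorem armProb_mem {K : ℕ} [NeZero K] (s : State K) : armProb s ∈ stdSimplex ℝ (Fin K) := by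
  unfold armProb
  split
  · exact single_mem_stdSimplex ℝ _
  · exact tsallisWeights_mem _ _

theorem measurable_nextState {K : ℕ} [NeZero K] (T : ℕ) (lam : ℝ) :
    Measurable fun x : State K × Step K => nextState T lam x.1 x.2.1 (x.2.2 x.2.1) := by
  have key : Measurable fun x : (Control K × Fin K) × (((Fin K → ℝ) × ℝ) × Loss K) =>
      nextState T lam (x.1.1, x.2.1) x.1.2 (x.2.2 x.1.2) := by
    refine measurable_from_prod_countable_right fun c => ?_
    obtain ⟨c, i⟩ := c
    have hw : Measurable fun y : ((Fin K → ℝ) × ℝ) × Loss K => stateWeights (c, y.1) i :=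
      (measurable_pi_apply i).comp (measurable_stateWeights.comp
        (measurable_const.prodMk measurable_fst))
    have hx : Measurable fun y : ((Fin K → ℝ) × ℝ) × Loss K => ((y.2 i : unitInterval) : ℝ) :=
      measurable_subtype_coe.comp ((measurable_pi_apply i).comp measurable_snd)
    have hsingle : Measurable fun r : ℝ => (Pi.single i r : Fin K → ℝ) := by
      refine measurable_pi_iff.mpr fun j => ?_
      by_cases hj : j = i
      · subst hj
        simp only [Pi.single_eq_same]
        exact measurable_id
      · simp [hj]
    have h1 : Measurable fun y : ((Fin K → ℝ) × ℝ) × Loss K => y.1.1 :=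
      measurable_fst.comp measurable_fst
    have h2 : Measurable fun y : ((Fin K → ℝ) × ℝ) × Loss K => y.1.2 + (y.2 i : ℝ) :=
      (measurable_snd.comp measurable_fst).add hx
    unfold nextState estimate
    dsimp only
    have e1 := h1.add (hsingle.comp (hx.div hw))
    have e2 := h1.add (hsingle.comp ((h2.div_const (blockSize K T lam : ℝ)).div hw))
    split_ifs
    all_goals first
      | exact measurable_const
      | exact measurable_const.prodMk (e1.prodMk measurable_const)
      | exact measurable_const.prodMk (e2.prodMk measurable_const)
      | exact measurable_const.prodMk (h1.prodMk h2)
  exact key.comp (g := fun x : (Control K × Fin K) × (((Fin K → ℝ) × ℝ) × Loss K) =>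
      nextState T lam (x.1.1, x.2.1) x.1.2 (x.2.2 x.1.2))
    (f := fun x : State K × Step K => ((x.1.1, x.2.1), (x.1.2, x.2.2))) (by fun_prop)

theorem measurable_run {K : ℕ} [NeZero K] (T : ℕ) (lam : ℝ) (t : ℕ) :
    Measurable (run T lam t : History K t → State K) := by
  induction t with
  | zero => exact measurable_const
  | succ t ih =>
    have h1 : Measurable fun h : History K (t + 1) => (Fin.init h : History K t) :=
      measurable_pi_iff.mpr fun i => measurable_pi_apply _
    exact (measurable_nextState T lam).comp
      ((ih.comp h1).prodMk (measurable_pi_apply (Fin.last t)))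

/-- The conditional law of the next arm of the learner, given the past. -/
noncomputable def armKernel {K : ℕ} [NeZero K] (T : ℕ) (lam : ℝ) (t : ℕ) :
    Kernel (History K t) (Fin K) where
  toFun h := ∑ i, ENNReal.ofReal (armProb (run T lam t h) i) • Measure.dirac i
  measurable' := by
    refine Measure.measurable_of_measurable_coe _ fun s _ => ?_
    simp only [Measure.coe_finsetSum, Finset.sum_apply, Measure.smul_apply, smul_eq_mul]
    refine Finset.measurable_sum _ fun i _ => Measurable.mul_const ?_ _
    exact ENNReal.measurable_ofReal.comp
      ((measurable_pi_apply i).comp (measurable_armProb.comp (measurable_run T lam t)))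

instance {K : ℕ} [NeZero K] (T : ℕ) (lam : ℝ) (t : ℕ) :
    IsMarkovKernel (armKernel (K := K) T lam t) := by
  refine ⟨fun h => ⟨?_⟩⟩
  have hm := armProb_mem (run T lam t h)
  change (∑ i, ENNReal.ofReal (armProb (run T lam t h) i) • Measure.dirac i :
    Measure (Fin K)) Set.univ = 1
  simp only [Measure.coe_finsetSum, Finset.sum_apply, Measure.smul_apply, smul_eq_mul,
    measure_univ, mul_one]
  rw [← ENNReal.ofReal_sum_of_nonneg fun i _ => hm.1 i, hm.2, ENNReal.ofReal_one]

/-! ### Environments and the law of the game -/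

/-- An environment: the conditional law of the next loss vector, given all losses and all arms of
the past rounds. -/
structure Environment (K : ℕ) where
  /-- the law of the loss vector of round `t`, given the rounds before `t` -/
  lossKernel : (t : ℕ) → Kernel (History K t) (Loss K)
  isMarkov : ∀ t, IsMarkovKernel (lossKernel t)

instance {K : ℕ} (env : Environment K) (t : ℕ) : IsMarkovKernel (env.lossKernel t) :=
  env.isMarkov t

/-- The oblivious adversary, which fixes the loss vectors before the game. -/
noncomputable def oblivious {K : ℕ} (l : ℕ → Loss K) : Environment K where
  lossKernel t := Kernel.const _ (Measure.dirac (l t))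
  isMarkov _ := inferInstance

/-- The law of the first `t` rounds when the algorithm with horizon `T` and switching cost `lam`
plays against `env`. In each round, the arm and the loss vector are drawn independently of each
other, given the past. -/
noncomputable def gameLaw {K : ℕ} [NeZero K] (T : ℕ) (lam : ℝ) (env : Environment K) :
    (t : ℕ) → Measure (History K t)
  | 0 => Measure.dirac Fin.elim0
  | t + 1 => (gameLaw T lam env t ⊗ₘ (armKernel T lam t ×ₖ env.lossKernel t)).map
      fun x => (Fin.snoc x.1 x.2 : History K (t + 1))

theorem measurable_snoc (K t : ℕ) :
    Measurable fun x : History K t × Step K => (Fin.snoc x.1 x.2 : History K (t + 1)) := by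
  refine measurable_pi_iff.mpr fun i => ?_
  refine Fin.lastCases ?_ (fun j => ?_) i
  · simp only [Fin.snoc_last]
    exact measurable_snd
  · simp only [Fin.snoc_castSucc]
    exact (measurable_pi_apply j).comp measurable_fst

instance {K : ℕ} [NeZero K] (T : ℕ) (lam : ℝ) (env : Environment K) (t : ℕ) :
    IsProbabilityMeasure (gameLaw T lam env t) := by
  induction t with
  | zero => unfold gameLaw; infer_instance
  | succ t ih => exact Measure.isProbabilityMeasure_map (measurable_snoc K t).aemeasurable

/-- The constant-gap condition: given any past, the expected loss of every arm `i ≠ istar` in the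
next round exceeds that of `istar` by exactly `Δ i`. -/
def Environment.IsStochasticallyConstrained {K : ℕ} (env : Environment K) (istar : Fin K)
    (Δ : Fin K → ℝ) : Prop :=
  ∀ (t : ℕ) (h : History K t) (i : Fin K), i ≠ istar →
    ∫ l, ((l i : ℝ) - (l istar : ℝ)) ∂(env.lossKernel t h) = Δ i

/-- The environment does not react to the arm of the current block before that block is over: the
law of the next loss vector depends on the past losses and on the past arms, except the arms of
those past rounds that belong to the current block of the learner. In the first phase there are
no such rounds, and this is no restriction. -/
def Environment.ReactsOnlyToFinishedBlocks {K : ℕ} [NeZero K] (env : Environment K) (T : ℕ)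
    (lam : ℝ) : Prop :=
  ∀ (t : ℕ) (h h' : History K t), (∀ r, (h r).2 = (h' r).2) →
    (∀ r : Fin t, (r : ℕ) + (run T lam t h).1.pos < t → (h r).1 = (h' r).1) →
    env.lossKernel t h = env.lossKernel t h'

/-! ### Regret -/

/-- The arm played before round `t`; `none` for the first round. -/
def prevArm {K T : ℕ} (h : History K T) (t : Fin T) : Option (Fin K) :=
  if 0 < (t : ℕ) then some (h ⟨t - 1, by omega⟩).1 else none

/-- The number of switches `∑_t 1{I_t ≠ I_{t-1}}`, where the first play counts as a switch. -/
def numSwitches {K T : ℕ} (h : History K T) : ℕ :=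
  ∑ t : Fin T, if prevArm h t = some (h t).1 then 0 else 1

/-- The pseudo-regret with switching cost
`∑_t ℓ_{t,I_t} - min_i ∑_t E[ℓ_{t,i}] + λ ∑_t 1{I_t ≠ I_{t-1}}`
of a game of `T` rounds with law `μ`. -/
noncomputable def pseudoRegret {K T : ℕ} (lam : ℝ) (μ : Measure (History K T))
    (h : History K T) : ℝ :=
  ∑ t, ((h t).2 (h t).1 : ℝ) - (⨅ i : Fin K, ∑ t, ∫ g, ((g t).2 i : ℝ) ∂μ)
    + lam * numSwitches h

/-- The expected pseudo-regret with switching cost of the algorithm against `env`. -/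
noncomputable def expectedRegret {K : ℕ} [NeZero K] (T : ℕ) (lam : ℝ) (env : Environment K) : ℝ :=
  ∫ h, pseudoRegret lam (gameLaw T lam env T) h ∂(gameLaw T lam env T)

end SwitchTsallis

/-!
The proof rests on one inequality for Tsallis-INF and on potential functions of the memory of the
learner.

**One step of Tsallis-INF.** Let `m_n(L)` be the minimum of the objective with learning rate
`2 / √n`, and `leaderGap i₀ n L = L i₀ - 2 √n - m_n(L)`, which is nonnegative and vanishes at the
start of a phase. `tsallis_step` says that in every update the expected regret against `i₀`, plus
the expected increase of `leaderGap`, is at most `9 / √n * ∑_{i ≠ i₀} √pᵢ`. The first-order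
condition at the minimiser turns the stability term into `y (p_j - q_j)` minus a Bregman divergence.
When the arm drawn is `i₀` itself and `p_{i₀} ≥ 3/4`, the increment is shifted by a constant vector,
so that it falls on the other arms; this is what removes `i₀` from the sum. With `∑ √pᵢ ≤ √K` the
inequality gives the worst-case bound, and with `√pᵢ / √n ≲ pᵢ Δᵢ + 1 / (n Δᵢ)` the regret bounds
itself (`firstPhase_gap_le`), which gives the logarithmic bound.

**Blocks.** Inside a block the loss vectors may depend on the arms of earlier blocks but not on the
arm of the current one. Hence the law of the history is invariant under drawing the arm of the
current block anew from the distribution it was drawn from (`lintegral_swapArm`), and at the end of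
a block `tsallis_step` applies to the averages of the losses of all arms over the block.
`integral_cum_le_of_potential` turns such one-round inequalities into inequalities between expected
sums of costs; the potentials are nonnegative, and their expectations are handled as Lebesgue
integrals, because the loss estimates have no uniform bound at hand. `integral_secondPhase_le`
bounds the whole second phase by `entryCost`, paid at the moment of entry, which is of order
`(λK)^{1/3} T^{2/3} = λ * threshold`.

**Switches.** The first phase makes at most `threshold + 1` switches, which settles the worst case.
In the stochastically constrained case the second phase is entered only after `threshold` switches,
so that `entryCost * P(entry)` is of order `λ E[S]`, where `S` counts the switches of the first
phase. Of two different consecutive arms one is not `i⋆`, so `E[S] ≤ 1 + 2 R / Δ_min`, where `R`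
is the regret of the first phase.
-/

namespace SwitchTsallis

open scoped ENNReal

/-! ### One step of Tsallis-INF -/

theorem tsallisObjective_two_div_sqrt {K : ℕ} (L : Fin K → ℝ) (n : ℕ) (p : Fin K → ℝ) :
    tsallisObjective L (2 / √(n : ℝ)) p = ∑ i, L i * p i - 2 * √(n : ℝ) * ∑ i, √(p i) := by
  unfold tsallisObjective
  rw [one_div_div, ← Finset.mul_sum]
  ring

/-- Every arm has positive probability: near `0` the square root outweighs any linear term. -/
theorem tsallisWeights_pos {K : ℕ} [NeZero K] (L : Fin K → ℝ) {n : ℕ} (hn : 0 < n) (k : Fin K) :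
    0 < tsallisWeights L (2 / √(n : ℝ)) k := by
  set p := tsallisWeights L (2 / √(n : ℝ)) with hp
  have hpm : p ∈ stdSimplex ℝ (Fin K) := tsallisWeights_mem L _
  have hmin : IsMinOn _ _ p := tsallisWeights_isMinOn L (2 / √(n : ℝ))
  have hc : 0 < √(n : ℝ) := Real.sqrt_pos.2 (by exact_mod_cast hn)
  rcases (hpm.1 k).lt_or_eq with h | h
  · exact h
  exfalso
  set c := √(n : ℝ)
  set s := ∑ i, √(p i) with hs
  have hs0 : 0 ≤ s := Finset.sum_nonneg fun i _ => Real.sqrt_nonneg _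
  set D := |L k - ∑ i, L i * p i| + 2 * c * s + 1 with hD
  have hD0 : 0 < D := by positivity
  -- Moving the mass `u ^ 2` to `k` gains `2 * c * u` and loses at most `u ^ 2 * D ≤ c * u`.
  set u := min (1 / 2) (c / D) with hu
  have hu0 : 0 < u := lt_min (by norm_num) (by positivity)
  have hu1 : u ≤ 1 / 2 := min_le_left _ _
  have huD : u * D ≤ c := by
    have : u ≤ c / D := min_le_right _ _
    rwa [le_div_iff₀ hD0] at this
  have hq : (1 - u ^ 2) • p + (u ^ 2) • (Pi.single k 1 : Fin K → ℝ) ∈ stdSimplex ℝ (Fin K) :=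
    convex_stdSimplex ℝ (Fin K) hpm (single_mem_stdSimplex ℝ k) (by nlinarith) (by positivity)
      (by ring)
  have h1 : tsallisObjective L (2 / √(n : ℝ)) p ≤ _ := hmin hq
  rw [tsallisObjective_two_div_sqrt, tsallisObjective_two_div_sqrt] at h1
  have hl : ∑ i, L i * ((1 - u ^ 2) • p + (u ^ 2) • (Pi.single k 1 : Fin K → ℝ)) i
      = (1 - u ^ 2) * ∑ i, L i * p i + u ^ 2 * L k := by
    have : ∑ i, L i * (Pi.single k (1 : ℝ) : Fin K → ℝ) i = L k := by
      simp [Pi.single_apply]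
    rw [← this, Finset.mul_sum, Finset.mul_sum, ← Finset.sum_add_distrib]
    refine Finset.sum_congr rfl fun i _ => ?_
    simp only [smul_eq_mul, Pi.add_apply, Pi.smul_apply]
    ring
  have hr : (1 - u ^ 2) * s + u
      ≤ ∑ i, √(((1 - u ^ 2) • p + (u ^ 2) • (Pi.single k 1 : Fin K → ℝ)) i) := by
    have e1 : (1 - u ^ 2) * s + u
        = ∑ i, ((1 - u ^ 2) * √(p i) + (Pi.single k u : Fin K → ℝ) i) := by
      rw [Finset.sum_add_distrib, ← Finset.mul_sum, Finset.sum_pi_single']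
      simp [hs]
    rw [e1]
    refine Finset.sum_le_sum fun i _ => ?_
    simp only [smul_eq_mul, Pi.add_apply, Pi.smul_apply]
    by_cases hik : i = k
    · subst hik
      simp [← h, Real.sqrt_sq hu0.le]
    · simp only [Pi.single_eq_of_ne hik, mul_zero, add_zero]
      rw [Real.sqrt_mul (by nlinarith)]
      gcongr
      refine Real.le_sqrt_of_sq_le ?_
      have h2 : 0 ≤ u ^ 2 * (1 - u ^ 2) := mul_nonneg (by positivity) (by nlinarith)
      linarith
  rw [hl, ← hs] at h1
  change _ - 2 * c * _ ≤ _ - 2 * c * _ at h1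
  have h2 := mul_le_mul_of_nonneg_left hr (by positivity : 0 ≤ 2 * c)
  have h3 := le_abs_self (L k - ∑ i, L i * p i)
  have h4 : u ^ 2 * (L k - ∑ i, L i * p i) ≤ u ^ 2 * |L k - ∑ i, L i * p i| := by gcongr
  have h5 : u * (u * D) ≤ u * c := by gcongr
  have h6 : 0 < u * c := by positivity
  have h7 : 0 < u ^ 2 := by positivity
  rw [hD] at h5
  have h8 : c * s * u ^ 2 ≥ 0 := by positivity
  nlinarith

/-- The first-order optimality condition for the Tsallis-INF distribution. -/
theorem tsallisWeights_first_order {K : ℕ} [NeZero K] (L : Fin K → ℝ) {n : ℕ} (hn : 0 < n)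
    {q : Fin K → ℝ} (hq : q ∈ stdSimplex ℝ (Fin K)) :
    √(n : ℝ) * ∑ i, (q i - tsallisWeights L (2 / √(n : ℝ)) i) /
        √(tsallisWeights L (2 / √(n : ℝ)) i)
      ≤ ∑ i, L i * (q i - tsallisWeights L (2 / √(n : ℝ)) i) := by
  have hpos := tsallisWeights_pos L hn
  set p := tsallisWeights L (2 / √(n : ℝ)) with hp
  have hpm : p ∈ stdSimplex ℝ (Fin K) := tsallisWeights_mem L _
  have hmin : IsMinOn _ _ p := tsallisWeights_isMinOn L (2 / √(n : ℝ))
  set c := √(n : ℝ)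
  let φ : ℝ → ℝ := fun s => ∑ i, L i * (p i + s * (q i - p i))
    - 2 * c * ∑ i, √(p i + s * (q i - p i))
  have hφ : HasDerivAt φ (∑ i, L i * (q i - p i) - 2 * c * ∑ i, (q i - p i) / (2 * √(p i))) 0 := by
    have hlin : ∀ i, HasDerivAt (fun s : ℝ => p i + s * (q i - p i)) (q i - p i) 0 := fun i => by
      simpa using ((hasDerivAt_id (0 : ℝ)).mul_const (q i - p i)).const_add (p i)
    refine HasDerivAt.sub ?_ (HasDerivAt.const_mul _ ?_)
    · exact HasDerivAt.fun_sum fun i _ => (hlin i).const_mul (L i)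
    · refine HasDerivAt.fun_sum fun i _ => ?_
      have := (hlin i).sqrt (by simpa using (hpos i).ne')
      simpa using this
  have ht := hφ.tendsto_slope_zero_right
  have h0 := ge_of_tendsto (b := (0 : ℝ)) ht (by
    filter_upwards [Ioo_mem_nhdsGT (zero_lt_one (α := ℝ))] with s hs
    have hmem : (fun i => p i + s * (q i - p i)) ∈ stdSimplex ℝ (Fin K) := by
      have := convex_stdSimplex ℝ (Fin K) hpm hq (by linarith [hs.2] : 0 ≤ 1 - s) hs.1.le (by ring)
      convert this using 1
      ext i
      simp only [smul_eq_mul, Pi.add_apply, Pi.smul_apply]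
      ring
    have h1 : tsallisObjective L (2 / √(n : ℝ)) p ≤ _ := hmin hmem
    rw [tsallisObjective_two_div_sqrt, tsallisObjective_two_div_sqrt] at h1
    have hs' := hs.1
    simp only [φ, zero_add, zero_mul, add_zero, smul_eq_mul]
    refine mul_nonneg (inv_nonneg.2 hs'.le) ?_
    linarith)
  have e : 2 * c * ∑ i, (q i - p i) / (2 * √(p i)) = c * ∑ i, (q i - p i) / √(p i) := by
    rw [Finset.mul_sum, Finset.mul_sum]
    refine Finset.sum_congr rfl fun i _ => ?_
    have := (Real.sqrt_pos.2 (hpos i)).ne'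
    field_simp
  linarith

/-- The minimal value of the Tsallis-INF objective with learning rate `2 / √n`; for `n = 0` the
objective is linear. -/
noncomputable def tsallisValue {K : ℕ} [NeZero K] (L : Fin K → ℝ) (n : ℕ) : ℝ :=
  tsallisObjective L (2 / √(n : ℝ)) (tsallisWeights L (2 / √(n : ℝ)))

theorem tsallisValue_le {K : ℕ} [NeZero K] (L : Fin K → ℝ) (n : ℕ) {q : Fin K → ℝ}
    (hq : q ∈ stdSimplex ℝ (Fin K)) :
    tsallisValue L n ≤ ∑ i, L i * q i - 2 * √(n : ℝ) * ∑ i, √(q i) := by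
  rw [← tsallisObjective_two_div_sqrt]
  exact tsallisWeights_isMinOn L _ hq

theorem tsallisValue_eq {K : ℕ} [NeZero K] (L : Fin K → ℝ) (n : ℕ) :
    tsallisValue L n = ∑ i, L i * tsallisWeights L (2 / √(n : ℝ)) i
      - 2 * √(n : ℝ) * ∑ i, √(tsallisWeights L (2 / √(n : ℝ)) i) :=
  tsallisObjective_two_div_sqrt _ _ _

theorem continuous_tsallisValue {K : ℕ} [NeZero K] (n : ℕ) :
    Continuous fun L : Fin K → ℝ => tsallisValue L n := by
  have key : ∀ L L' : Fin K → ℝ, tsallisValue L n ≤ tsallisValue L' n + K * dist L L' := by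
    intro L L'
    have hm := tsallisWeights_mem L' (2 / √(n : ℝ))
    have h1 := tsallisValue_le L n hm
    rw [tsallisValue_eq L']
    have h2 : ∑ i, L i * tsallisWeights L' (2 / √(n : ℝ)) i
        ≤ ∑ i, (L' i * tsallisWeights L' (2 / √(n : ℝ)) i + dist L L') := by
      refine Finset.sum_le_sum fun i _ => ?_
      have h3 : L i - L' i ≤ dist L L' :=
        (le_abs_self _).trans ((Real.dist_eq _ _).symm.le.trans (dist_le_pi_dist L L' i))
      have h4 : tsallisWeights L' (2 / √(n : ℝ)) i ≤ 1 :=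
        hm.2 ▸ Finset.single_le_sum (fun i _ => hm.1 i) (Finset.mem_univ i)
      nlinarith [hm.1 i, dist_nonneg (x := L) (y := L')]
    rw [Finset.sum_add_distrib] at h2
    simp only [Finset.sum_const, Finset.card_univ, Fintype.card_fin, nsmul_eq_mul] at h2
    linarith
  refine (LipschitzWith.of_dist_le_mul (K := K) fun L L' => ?_).continuous
  rw [Real.dist_eq, abs_le]
  have h1 := key L L'
  have h2 := key L' L
  rw [dist_comm] at h2
  simp only [NNReal.coe_natCast]
  constructor <;> linarith

/-- The suboptimality of `q` is at least its Bregman divergence from the minimiser. -/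
theorem tsallisValue_add_bregman_le {K : ℕ} [NeZero K] (L : Fin K → ℝ) {n : ℕ} (hn : 0 < n)
    {q : Fin K → ℝ} (hq : q ∈ stdSimplex ℝ (Fin K)) :
    tsallisValue L n + √(n : ℝ) * ∑ i, (√(q i) - √(tsallisWeights L (2 / √(n : ℝ)) i)) ^ 2 /
        √(tsallisWeights L (2 / √(n : ℝ)) i)
      ≤ ∑ i, L i * q i - 2 * √(n : ℝ) * ∑ i, √(q i) := by
  have hpos := tsallisWeights_pos L hn
  have hfo := tsallisWeights_first_order L hn hq
  rw [tsallisValue_eq]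
  set p := tsallisWeights L (2 / √(n : ℝ)) with hp
  have e : ∑ i, (√(q i) - √(p i)) ^ 2 / √(p i)
      = ∑ i, (q i - p i) / √(p i) + 2 * ∑ i, √(p i) - 2 * ∑ i, √(q i) := by
    rw [Finset.mul_sum, Finset.mul_sum, ← Finset.sum_add_distrib, ← Finset.sum_sub_distrib]
    refine Finset.sum_congr rfl fun i _ => ?_
    have h1 := Real.sqrt_pos.2 (hpos i)
    have h2 := Real.sq_sqrt (hpos i).le
    have h3 := Real.sq_sqrt (hq.1 i)
    rw [div_add' _ _ _ h1.ne', div_sub' h1.ne', div_left_inj' h1.ne']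
    nlinarith
  rw [e]
  simp only [mul_sub, Finset.sum_sub_distrib] at hfo
  linarith

/-- The stability of the coordinate of the arm drawn, with `a = √p` and `b = √q`. -/
theorem sub_sq_stability_le {a b c y : ℝ} (ha : 0 < a) (hc : 0 < c) (hy : 0 ≤ y) :
    y * (a ^ 2 - b ^ 2) - c * ((b - a) ^ 2 / a) ≤ y ^ 2 * a ^ 3 / c := by
  have h1 : y * (a ^ 2 - b ^ 2) ≤ 2 * a * y * (a - b) := by
    nlinarith [mul_nonneg hy (sq_nonneg (a - b))]
  have h2 : y ^ 2 * a ^ 3 / c - 2 * a * y * (a - b) + c * ((b - a) ^ 2 / a)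
      = c / a * ((a - b) - y * a ^ 2 / c) ^ 2 := by
    field_simp
    ring
  have h3 : 0 ≤ c / a * ((a - b) - y * a ^ 2 / c) ^ 2 := by positivity
  linarith

/-- The stability of another coordinate after the shift of the increment, with `a = √p` and
`b = √q`. The quadratic term `y * (b - a) ^ 2` is absorbed by the divergence because `a ≤ 1 / 2`
and `y ≤ 4 / 3`. -/
theorem sq_sub_stability_le {a b c y : ℝ} (ha : 0 < a) (ha2 : a ≤ 1 / 2) (hb : 0 ≤ b) (hc : 1 ≤ c)
    (hy : 0 ≤ y) (hy2 : y ≤ 4 / 3) :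
    y * (b ^ 2 - a ^ 2) - c * ((b - a) ^ 2 / a) ≤ 6 * a / c := by
  have hc0 : 0 < c := by linarith
  have hz : (b - a) ^ 2 / a * a = (b - a) ^ 2 := div_mul_cancel₀ _ ha.ne'
  have hz0 : 0 ≤ (b - a) ^ 2 / a := by positivity
  rcases le_total b a with h | h
  · have h1 : y * (b ^ 2 - a ^ 2) ≤ 0 := mul_nonpos_of_nonneg_of_nonpos hy (by nlinarith)
    have h2 : 0 ≤ 6 * a / c := by positivity
    nlinarith
  · have h1 : y * (b ^ 2 - a ^ 2) ≤ 4 / 3 * (b ^ 2 - a ^ 2) := by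
      apply mul_le_mul_of_nonneg_right hy2
      nlinarith
    have h2 : (b - a) ^ 2 ≤ c * ((b - a) ^ 2 / a) / 2 := by nlinarith
    have h3 : 6 * a / c - 8 / 3 * a * (b - a) + c * ((b - a) ^ 2 / a) / 3
        = c / (3 * a) * ((b - a) - 4 * a ^ 2 / c) ^ 2 + (6 * a - 16 / 3 * a ^ 3) / c := by
      field_simp
      ring
    have h4 : 0 ≤ c / (3 * a) * ((b - a) - 4 * a ^ 2 / c) ^ 2 := by positivity
    have h5 : 0 ≤ (6 * a - 16 / 3 * a ^ 3) / c := by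
      apply div_nonneg _ hc0.le
      nlinarith [mul_pos ha ha, mul_pos (mul_pos ha ha) ha]
    nlinarith

/-- The stability term of an update of the arm `j` by `y`: a bound that suits every arm, and a bound
by the other arms alone for an arm of large probability. -/
theorem tsallis_stability {K : ℕ} [NeZero K] (L : Fin K → ℝ) {n : ℕ} (hn : 0 < n) (j : Fin K)
    {y : ℝ} (hy : 0 ≤ y) :
    y * tsallisWeights L (2 / √(n : ℝ)) j + tsallisValue L n - tsallisValue (L + Pi.single j y) n
      ≤ y ^ 2 * √(tsallisWeights L (2 / √(n : ℝ)) j) ^ 3 / √(n : ℝ) ∧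
    (3 / 4 ≤ tsallisWeights L (2 / √(n : ℝ)) j → y ≤ 4 / 3 →
      y * tsallisWeights L (2 / √(n : ℝ)) j + tsallisValue L n
          - tsallisValue (L + Pi.single j y) n
        ≤ ∑ i with i ≠ j, 6 * √(tsallisWeights L (2 / √(n : ℝ)) i) / √(n : ℝ)) := by
  have hpos := tsallisWeights_pos L hn
  set q := tsallisWeights (L + Pi.single j y) (2 / √(n : ℝ)) with hqdef
  have hq : q ∈ stdSimplex ℝ (Fin K) := tsallisWeights_mem _ _
  have hB := tsallisValue_add_bregman_le L hn hq
  have hpm := tsallisWeights_mem L (2 / √(n : ℝ))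
  set p := tsallisWeights L (2 / √(n : ℝ)) with hp
  have hc1 : 1 ≤ √(n : ℝ) := Real.one_le_sqrt.2 (by exact_mod_cast hn)
  set c := √(n : ℝ)
  have hc : 0 < c := by linarith
  have hv : tsallisValue (L + Pi.single j y) n
      = ∑ i, L i * q i + y * q j - 2 * c * ∑ i, √(q i) := by
    rw [tsallisValue_eq]
    congr 1
    simp only [Pi.add_apply, add_mul, Finset.sum_add_distrib]
    congr 1
    simp [Pi.single_apply, q]
  have hmain : y * p j + tsallisValue L n - tsallisValue (L + Pi.single j y) n
      ≤ y * (p j - q j) - ∑ i, c * ((√(q i) - √(p i)) ^ 2 / √(p i)) := by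
    rw [hv, ← Finset.mul_sum]
    linarith
  have hnn : ∀ i, 0 ≤ c * ((√(q i) - √(p i)) ^ 2 / √(p i)) := fun i => by positivity
  have hsp : ∀ i, √(p i) ^ 2 = p i := fun i => Real.sq_sqrt (hpos i).le
  have hsq : ∀ i, √(q i) ^ 2 = q i := fun i => Real.sq_sqrt (hq.1 i)
  constructor
  · refine hmain.trans ?_
    have h1 := Finset.single_le_sum (fun i _ => hnn i) (Finset.mem_univ j)
    have h2 := sub_sq_stability_le (b := √(q j)) (Real.sqrt_pos.2 (hpos j)) hc hy
    rw [hsp, hsq] at h2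
    linarith
  · intro hj hy2
    refine hmain.trans ?_
    have hsum : ∀ r ∈ stdSimplex ℝ (Fin K), r j = 1 - ∑ i with i ≠ j, r i := fun r hr => by
      rw [Finset.filter_ne', ← hr.2, ← Finset.add_sum_erase _ _ (Finset.mem_univ j)]
      ring
    have h1 : ∑ i with i ≠ j, c * ((√(q i) - √(p i)) ^ 2 / √(p i))
        ≤ ∑ i, c * ((√(q i) - √(p i)) ^ 2 / √(p i)) :=
      Finset.sum_le_sum_of_subset_of_nonneg (Finset.filter_subset _ _) fun i _ _ => hnn i
    -- Both `p` and `q` sum to one: this is the shift of the increment by the constant `-y`.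
    have h2 : y * (p j - q j) = ∑ i with i ≠ j, y * (q i - p i) := by
      rw [hsum p hpm, hsum q hq, ← Finset.mul_sum, Finset.sum_sub_distrib]
      ring
    have h3 : ∑ i with i ≠ j, (y * (q i - p i) - c * ((√(q i) - √(p i)) ^ 2 / √(p i)))
        ≤ ∑ i with i ≠ j, 6 * √(p i) / c := by
      refine Finset.sum_le_sum fun i hi => ?_
      rw [Finset.mem_filter] at hi
      have hpi : p i ≤ 1 / 4 := by
        have := Finset.single_le_sum (f := p) (fun i _ => hpm.1 i)
          (Finset.mem_filter.2 ⟨Finset.mem_univ i, hi.2⟩ : i ∈ Finset.univ.filter (· ≠ j))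
        linarith [hsum p hpm]
      have ha : √(p i) ≤ 1 / 2 := Real.sqrt_le_iff.2 ⟨by norm_num, by linarith⟩
      have := sq_sub_stability_le (Real.sqrt_pos.2 (hpos i)) ha (Real.sqrt_nonneg (q i)) hc1 hy hy2
      rwa [hsp, hsq] at this
    rw [Finset.sum_sub_distrib] at h3
    linarith

/-- The amount by which the arm `i₀`, with its regularisation `-2 √n`, exceeds the minimum of the
objective. It is the potential of Tsallis-INF after `n` updates; the learning rate `2 / √0 = 0`
at `n = 0` means that there is no regularisation, as `1 / 0 = 0`. -/
noncomputable def leaderGap {K : ℕ} [NeZero K] (i₀ : Fin K) (n : ℕ) (L : Fin K → ℝ) : ℝ :=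
  L i₀ - 2 * √(n : ℝ) - tsallisValue L n

theorem leaderGap_nonneg {K : ℕ} [NeZero K] (i₀ : Fin K) (n : ℕ) (L : Fin K → ℝ) :
    0 ≤ leaderGap i₀ n L := by
  have h := tsallisValue_le L n (single_mem_stdSimplex ℝ i₀)
  have h1 : ∑ i, L i * (Pi.single i₀ (1 : ℝ) : Fin K → ℝ) i = L i₀ := by simp [Pi.single_apply]
  have h2 : ∑ i, √((Pi.single i₀ (1 : ℝ) : Fin K → ℝ) i) = 1 := by
    rw [Finset.sum_eq_single i₀] <;> simp +contextual
  rw [h1, h2] at h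
  unfold leaderGap
  linarith

theorem leaderGap_zero {K : ℕ} [NeZero K] (i₀ : Fin K) : leaderGap i₀ 0 0 = 0 := by
  simp [leaderGap, tsallisValue_eq]

theorem measurable_leaderGap {K : ℕ} [NeZero K] (i₀ : Fin K) (n : ℕ) :
    Measurable (leaderGap i₀ n) :=
  (((measurable_pi_apply i₀).sub measurable_const).sub (continuous_tsallisValue n).measurable)

theorem sqrt_succ_sub_le (n : ℕ) : √((n : ℝ) + 1) - √(n : ℝ) ≤ 1 / √((n : ℝ) + 1) := by
  have h : 0 < √((n : ℝ) + 1) := by positivity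
  rw [le_div_iff₀ h]
  have h1 := Real.sq_sqrt (by positivity : 0 ≤ (n : ℝ) + 1)
  have h2 := Real.sq_sqrt (by positivity : 0 ≤ (n : ℝ))
  have h3 : √(n : ℝ) ≤ √((n : ℝ) + 1) := Real.sqrt_le_sqrt (by linarith)
  nlinarith [Real.sqrt_nonneg (n : ℝ)]

theorem one_div_sqrt_succ_le (n : ℕ) :
    1 / √((n : ℝ) + 1) ≤ 2 * (√((n : ℝ) + 1) - √(n : ℝ)) := by
  have h : 0 < √((n : ℝ) + 1) := by positivity
  rw [div_le_iff₀ h]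
  have h1 := Real.sq_sqrt (by positivity : 0 ≤ (n : ℝ) + 1)
  have h2 := Real.sq_sqrt (by positivity : 0 ≤ (n : ℝ))
  nlinarith [sq_nonneg (√((n : ℝ) + 1) - √(n : ℝ))]

/-- One step of Tsallis-INF: the expected regret against `i₀` and the expected increase of the
potential. The arm `i₀` does not occur in the sum on the right. -/
theorem tsallis_step {K : ℕ} [NeZero K] (i₀ : Fin K) (n : ℕ) (L x : Fin K → ℝ)
    (hx0 : ∀ i, 0 ≤ x i) (hx1 : ∀ i, x i ≤ 1) (p : Fin K → ℝ)
    (hp : p = tsallisWeights L (2 / √((n : ℝ) + 1))) :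
    ∑ j, p j * (leaderGap i₀ (n + 1) (L + Pi.single j (x j / p j)) + x j)
      ≤ leaderGap i₀ n L + x i₀ + 9 / √((n : ℝ) + 1) * ∑ i with i ≠ i₀, √(p i) := by
  have hcast : ((n + 1 : ℕ) : ℝ) = (n : ℝ) + 1 := by push_cast; ring
  have hpos : ∀ i, 0 < p i := fun i => by
    rw [hp, ← hcast]; exact tsallisWeights_pos L n.succ_pos i
  have hpm : p ∈ stdSimplex ℝ (Fin K) := hp ▸ tsallisWeights_mem L _
  have hstab : ∀ j, _ := fun j =>
    tsallis_stability L n.succ_pos j (div_nonneg (hx0 j) (hpos j).le)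
  rw [hcast, ← hp] at hstab
  have hpen : tsallisValue L n - tsallisValue L (n + 1)
      ≤ 2 * (√((n : ℝ) + 1) - √(n : ℝ)) * ∑ i, √(p i) := by
    have h1 := tsallisValue_le L n hpm
    have h2 := tsallisValue_eq L (n + 1)
    rw [hcast, ← hp] at h2
    linarith
  set c := √((n : ℝ) + 1) with hcdef
  have hc1 : 1 ≤ c := Real.one_le_sqrt.2 (by linarith [(Nat.cast_nonneg n : (0 : ℝ) ≤ n)])
  have hc : 0 < c := by linarith
  set s := ∑ i with i ≠ i₀, √(p i) with hs
  have hs0 : 0 ≤ s := Finset.sum_nonneg fun i _ => Real.sqrt_nonneg _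
  have hple : ∀ i, p i ≤ 1 := fun i =>
    hpm.2 ▸ Finset.single_le_sum (fun i _ => hpm.1 i) (Finset.mem_univ i)
  have hsqle : ∀ i, √(p i) ≤ 1 := fun i => Real.sqrt_le_one.2 (hple i)
  have hsum : ∀ f : Fin K → ℝ, ∑ i, f i = f i₀ + ∑ i with i ≠ i₀, f i := fun f => by
    rw [Finset.filter_ne', ← Finset.add_sum_erase _ _ (Finset.mem_univ i₀)]
  -- `st j` is the stability term of drawing the arm `j`.
  set st : Fin K → ℝ := fun j => x j + tsallisValue L (n + 1)
    - tsallisValue (L + Pi.single j (x j / p j)) (n + 1) with hst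
  have hxp : ∀ j, x j / p j * p j = x j := fun j => div_mul_cancel₀ _ (hpos j).ne'
  have hst1 : ∀ j, p j * st j ≤ √(p j) / c := by
    intro j
    have h := (hstab j).1
    rw [hxp] at h
    refine (mul_le_mul_of_nonneg_left h (hpos j).le).trans ?_
    have hsj := Real.sqrt_pos.2 (hpos j)
    have e : p j * ((x j / p j) ^ 2 * √(p j) ^ 3 / c) = x j ^ 2 * (√(p j) / c) := by
      have h2 : √(p j) ^ 3 = p j * √(p j) := by rw [pow_succ, Real.sq_sqrt (hpos j).le]
      rw [h2]
      have := (hpos j).ne'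
      field_simp
    rw [e]
    have h3 : x j ^ 2 ≤ 1 := by nlinarith [hx0 j, hx1 j]
    have h4 : 0 ≤ √(p j) / c := by positivity
    nlinarith
  have hst2 : p i₀ * st i₀ ≤ 6 * s / c := by
    by_cases hbig : 3 / 4 ≤ p i₀
    · have hy : x i₀ / p i₀ ≤ 4 / 3 := by
        rw [div_le_iff₀ (hpos i₀)]
        linarith [hx1 i₀]
      have h := (hstab i₀).2 hbig hy
      rw [hxp, ← Finset.sum_div, ← Finset.mul_sum] at h
      have h1 : p i₀ * st i₀ ≤ p i₀ * (6 * s / c) := mul_le_mul_of_nonneg_left h (hpos i₀).le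
      have h2 : 0 ≤ 6 * s / c := by positivity
      nlinarith [hple i₀]
    · refine (hst1 i₀).trans ?_
      gcongr
      have h1 : 1 / 4 ≤ s := by
        have h2 := hsum p
        rw [hpm.2] at h2
        have h3 : ∑ i with i ≠ i₀, p i ≤ s := Finset.sum_le_sum fun i _ => by
          have := Real.sq_sqrt (hpos i).le
          nlinarith [hsqle i, Real.sqrt_nonneg (p i)]
        linarith
      linarith [hsqle i₀]
  have hstsum : ∑ j, p j * st j ≤ 7 * s / c := by
    rw [hsum]
    have : ∑ i with i ≠ i₀, p i * st i ≤ s / c := by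
      rw [hs, Finset.sum_div]
      exact Finset.sum_le_sum fun i _ => hst1 i
    have e : 7 * s / c = 6 * s / c + s / c := by ring
    linarith
  have hmain : ∑ j, p j * (leaderGap i₀ (n + 1) (L + Pi.single j (x j / p j)) + x j)
      = (L i₀ - 2 * c - tsallisValue L (n + 1)) + x i₀ + ∑ j, p j * st j := by
    have e : ∀ j, p j * (leaderGap i₀ (n + 1) (L + Pi.single j (x j / p j)) + x j)
        = p j * (L i₀ - 2 * c - tsallisValue L (n + 1)) + (if i₀ = j then x j else 0)
          + p j * st j := by
      intro j
      simp only [leaderGap, hst, Pi.add_apply, Pi.single_apply, hcast, ← hcdef]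
      split_ifs with h
      · linear_combination hxp j
      · ring
    simp only [e, Finset.sum_add_distrib, ← Finset.sum_mul, hpm.2]
    simp
  rw [hmain]
  have h1 : ∑ i, √(p i) - 1 ≤ s := by
    rw [hsum fun i => √(p i)]
    linarith [hsqle i₀]
  have h2 := sqrt_succ_sub_le n
  have h3 : √(n : ℝ) ≤ c := Real.sqrt_le_sqrt (by linarith)
  have h4 : 2 * (c - √(n : ℝ)) * (∑ i, √(p i) - 1) ≤ 2 * s / c := by
    have h5 : 2 * (c - √(n : ℝ)) * (∑ i, √(p i) - 1) ≤ 2 * (c - √(n : ℝ)) * s :=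
      mul_le_mul_of_nonneg_left h1 (by linarith)
    have h6 : 2 * (c - √(n : ℝ)) * s ≤ 2 * (1 / c) * s := by gcongr
    have e : 2 * s / c = 2 * (1 / c) * s := by ring
    linarith
  have e : 9 / c * s = 7 * s / c + 2 * s / c := by ring
  unfold leaderGap
  linarith

theorem sum_sqrt_ne_le {K : ℕ} {p : Fin K → ℝ} (hp : p ∈ stdSimplex ℝ (Fin K)) (i₀ : Fin K) :
    ∑ i with i ≠ i₀, √(p i) ≤ √(K : ℝ) := by
  refine Real.le_sqrt_of_sq_le ?_
  have h1 : ∑ i with i ≠ i₀, √(p i) ≤ ∑ i, √(p i) :=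
    Finset.sum_le_sum_of_subset_of_nonneg (Finset.filter_subset _ _) fun i _ _ => Real.sqrt_nonneg _
  have h0 : 0 ≤ ∑ i with i ≠ i₀, √(p i) := Finset.sum_nonneg fun i _ => Real.sqrt_nonneg _
  have h2 := sq_sum_le_card_mul_sum_sq (s := Finset.univ) (f := fun i => √(p i))
  have h3 : ∑ i, √(p i) ^ 2 = 1 := by
    rw [← hp.2]; exact Finset.sum_congr rfl fun i _ => Real.sq_sqrt (hp.1 i)
  simp only [h3, Finset.card_univ, Fintype.card_fin] at h2
  nlinarith

/-! ### One round of the game -/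

theorem measurable_init (K t : ℕ) :
    Measurable fun h : History K (t + 1) => (Fin.init h : History K t) :=
  measurable_pi_iff.mpr fun _ => measurable_pi_apply _

theorem measurable_armProb_run {K : ℕ} [NeZero K] (T : ℕ) (lam : ℝ) (t : ℕ) (i : Fin K) :
    Measurable fun h : History K t => armProb (run T lam t h) i :=
  (measurable_pi_apply i).comp (measurable_armProb.comp (measurable_run T lam t))

theorem measurable_stateWeights_run {K : ℕ} [NeZero K] (T : ℕ) (lam : ℝ) (t : ℕ) (i : Fin K) :
    Measurable fun h : History K t => stateWeights (run T lam t h) i :=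
  (measurable_pi_apply i).comp (measurable_stateWeights.comp (measurable_run T lam t))

theorem stateWeights_mem {K : ℕ} [NeZero K] (s : State K) :
    stateWeights s ∈ stdSimplex ℝ (Fin K) :=
  tsallisWeights_mem _ _

theorem sum_ofReal_eq_one {K : ℕ} {p : Fin K → ℝ} (hp : p ∈ stdSimplex ℝ (Fin K)) :
    ∑ i, ENNReal.ofReal (p i) = 1 := by
  rw [← ENNReal.ofReal_sum_of_nonneg fun i _ => hp.1 i, hp.2, ENNReal.ofReal_one]

theorem armKernel_apply {K : ℕ} [NeZero K] (T : ℕ) (lam : ℝ) (t : ℕ) (h : History K t) :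
    armKernel T lam t h
      = ∑ i, ENNReal.ofReal (armProb (run T lam t h) i) • Measure.dirac i := rfl

/-- One round of the game, for nonnegative functions of the history. -/
theorem lintegral_gameLaw_succ {K : ℕ} [NeZero K] (T : ℕ) (lam : ℝ) (env : Environment K) (t : ℕ)
    {F : History K (t + 1) → ℝ≥0∞} (hF : Measurable F) :
    ∫⁻ h, F h ∂(gameLaw T lam env (t + 1))
      = ∫⁻ h, ∫⁻ l, ∑ i, ENNReal.ofReal (armProb (run T lam t h) i) * F (Fin.snoc h (i, l))
          ∂(env.lossKernel t h) ∂(gameLaw T lam env t) := by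
  have hF' : Measurable fun x : History K t × Step K =>
      F (Fin.snoc x.1 x.2 : History K (t + 1)) := hF.comp (measurable_snoc K t)
  rw [gameLaw, lintegral_map hF (measurable_snoc K t), Measure.lintegral_compProd hF']
  refine lintegral_congr fun h => ?_
  have h1 : Measurable fun x : Step K => F (Fin.snoc h x) := hF'.comp measurable_prodMk_left
  rw [Kernel.prod_apply, lintegral_prod _ h1.aemeasurable, armKernel_apply,
    lintegral_finsetSum_measure, lintegral_finsetSum]
  · refine Finset.sum_congr rfl fun i _ => ?_
    rw [lintegral_smul_measure, lintegral_dirac, lintegral_const_mul]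
    · rfl
    · exact h1.comp measurable_prodMk_left
  · exact fun i _ => (h1.comp measurable_prodMk_left).const_mul _

theorem map_init_gameLaw {K : ℕ} [NeZero K] (T : ℕ) (lam : ℝ) (env : Environment K) (t : ℕ) :
    MeasurePreserving (fun h : History K (t + 1) => (Fin.init h : History K t))
      (gameLaw T lam env (t + 1)) (gameLaw T lam env t) := by
  refine ⟨measurable_init K t, Measure.ext_of_lintegral _ fun F hF => ?_⟩
  have hF' : Measurable fun h : History K (t + 1) => F (Fin.init h : History K t) :=
    hF.comp (measurable_init K t)
  rw [lintegral_map hF (measurable_init K t), lintegral_gameLaw_succ T lam env t hF']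
  refine lintegral_congr fun h => ?_
  simp only [Fin.init_snoc, ← Finset.sum_mul, sum_ofReal_eq_one (armProb_mem _), one_mul,
    lintegral_const, measure_univ, mul_one]

/-- One round of the game, for bounded functions of the history. -/
theorem integral_gameLaw_succ {K : ℕ} [NeZero K] (T : ℕ) (lam : ℝ) (env : Environment K) (t : ℕ)
    {F : History K (t + 1) → ℝ} (hF : Measurable F) {C : ℝ} (hC : ∀ h, |F h| ≤ C) :
    ∫ h, F h ∂(gameLaw T lam env (t + 1))
      = ∫ h, ∑ i, armProb (run T lam t h) i * ∫ l, F (Fin.snoc h (i, l))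
          ∂(env.lossKernel t h) ∂(gameLaw T lam env t) := by
  have hF' : Measurable fun x : History K t × Step K =>
      F (Fin.snoc x.1 x.2 : History K (t + 1)) := hF.comp (measurable_snoc K t)
  rw [gameLaw, integral_map (measurable_snoc K t).aemeasurable hF.aestronglyMeasurable,
    Measure.integral_compProd]
  · refine integral_congr_ae (Filter.Eventually.of_forall fun h => ?_)
    have h1 : Measurable fun x : Step K => F (Fin.snoc h x) := hF'.comp measurable_prodMk_left
    simp only
    rw [Kernel.prod_apply, integral_prod, armKernel_apply, integral_finsetSum_measure]
    · refine Finset.sum_congr rfl fun i _ => ?_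
      rw [integral_smul_measure, integral_dirac,
        ENNReal.toReal_ofReal ((armProb_mem _).1 i), smul_eq_mul]
    · exact fun i _ => ((integrable_dirac (by simp)).smul_measure ENNReal.ofReal_ne_top)
    · exact Integrable.of_bound h1.aestronglyMeasurable C
        (Filter.Eventually.of_forall fun x => hC _)
  · exact Integrable.of_bound hF'.aestronglyMeasurable C
      (Filter.Eventually.of_forall fun x => hC _)

/-! ### Evolution of the memory -/

theorem nextState_pos {K : ℕ} [NeZero K] (T : ℕ) (lam : ℝ) (s : State K) (i : Fin K) (x : ℝ) :
    (nextState T lam s i x).1.pos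
      = if s.1.inBlocks = true ∧ s.1.pos + 1 < blockSize K T lam then s.1.pos + 1 else 0 := by
  unfold nextState
  cases h : s.1.inBlocks
  · simp only [if_true]
    split_ifs <;> simp_all
  · by_cases h2 : blockSize K T lam ≤ s.1.pos + 1
    · simp [h2]
    · simp [h2, not_le.1 h2]

theorem nextState_inside {K : ℕ} [NeZero K] (T : ℕ) (lam : ℝ) (s : State K) (i : Fin K) (x : ℝ)
    (h1 : s.1.inBlocks = true) (h2 : s.1.pos + 1 < blockSize K T lam) :
    nextState T lam s i x = (⟨true, s.1.updates,
      s.1.switches + if s.1.last = some i then 0 else 1, some i, s.1.pos + 1⟩,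
      s.2.1, s.2.2 + x) := by
  unfold nextState
  simp [h1, not_le.2 h2]

theorem nextState_block_end {K : ℕ} [NeZero K] (T : ℕ) (lam : ℝ) (s : State K) (i : Fin K) (x : ℝ)
    (h1 : s.1.inBlocks = true) (h2 : blockSize K T lam ≤ s.1.pos + 1) :
    nextState T lam s i x = (⟨true, s.1.updates + 1,
      s.1.switches + if s.1.last = some i then 0 else 1, some i, 0⟩,
      s.2.1 + estimate s i ((s.2.2 + x) / blockSize K T lam), 0) := by
  unfold nextState
  simp [h1, h2]

theorem nextState_enter {K : ℕ} [NeZero K] (T : ℕ) (lam : ℝ) (s : State K) (i : Fin K) (x : ℝ)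
    (h1 : s.1.inBlocks = false)
    (h2 : switchThreshold K T lam ≤ (s.1.switches + if s.1.last = some i then 0 else 1 : ℕ)) :
    nextState T lam s i x = (⟨true, 0,
      s.1.switches + if s.1.last = some i then 0 else 1, some i, 0⟩, 0, 0) := by
  unfold nextState
  simp only [h1, if_true, if_pos h2]

theorem nextState_stay {K : ℕ} [NeZero K] (T : ℕ) (lam : ℝ) (s : State K) (i : Fin K) (x : ℝ)
    (h1 : s.1.inBlocks = false)
    (h2 : ¬ switchThreshold K T lam ≤ (s.1.switches + if s.1.last = some i then 0 else 1 : ℕ)) :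
    nextState T lam s i x = (⟨false, s.1.updates + 1,
      s.1.switches + if s.1.last = some i then 0 else 1, some i, 0⟩,
      s.2.1 + estimate s i x, 0) := by
  unfold nextState
  simp only [h1, if_true, if_neg h2]

theorem run_succ {K : ℕ} [NeZero K] (T : ℕ) (lam : ℝ) (t : ℕ) (h : History K (t + 1)) :
    run T lam (t + 1) h = nextState T lam (run T lam t (Fin.init h)) (h (Fin.last t)).1
      ((h (Fin.last t)).2 (h (Fin.last t)).1) := rfl

theorem run_snoc {K : ℕ} [NeZero K] (T : ℕ) (lam : ℝ) (t : ℕ) (h : History K t) (x : Step K) :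
    run T lam (t + 1) (Fin.snoc h x : History K (t + 1))
      = nextState T lam (run T lam t h) x.1 (x.2 x.1) := by
  rw [run_succ, Fin.init_snoc, Fin.snoc_last]

theorem blockSize_pos {K T : ℕ} {lam : ℝ} (hK : 0 < K) (hT : 0 < T) (hlam : 0 < lam) :
    0 < blockSize K T lam := by
  unfold blockSize
  rw [Nat.ceil_pos]
  positivity

/-- Invariants of the memory. They hold for all histories, also for those of probability zero. -/
theorem run_bounds {K : ℕ} [NeZero K] {T : ℕ} {lam : ℝ} (hB : 0 < blockSize K T lam)
    (t : ℕ) (h : History K t) :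
    ((run T lam t h).1.inBlocks = false →
      (run T lam t h).1.pos = 0 ∧ (run T lam t h).1.updates = t) ∧
    (run T lam t h).1.pos < blockSize K T lam ∧
    ((run T lam t h).1.inBlocks = true →
      blockSize K T lam * (run T lam t h).1.updates + (run T lam t h).1.pos ≤ t) ∧
    0 ≤ (run T lam t h).2.2 ∧ (run T lam t h).2.2 ≤ (run T lam t h).1.pos := by
  induction t with
  | zero => simp [run, initState, hB]
  | succ t ih =>
    obtain ⟨ih1, ih2, ih3, ih4, ih5⟩ := ih (Fin.init h)
    rw [run_succ]
    set s := run T lam t (Fin.init h)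
    set i := (h (Fin.last t)).1
    have hx0 : 0 ≤ ((h (Fin.last t)).2 i : ℝ) := ((h (Fin.last t)).2 i).2.1
    have hx1 : ((h (Fin.last t)).2 i : ℝ) ≤ 1 := ((h (Fin.last t)).2 i).2.2
    cases hb : s.1.inBlocks with
    | false =>
      obtain ⟨a1, a2⟩ := ih1 hb
      by_cases hth : switchThreshold K T lam
          ≤ (s.1.switches + if s.1.last = some i then 0 else 1 : ℕ)
      · rw [nextState_enter _ _ _ _ _ hb hth]
        simp [hB]
      · rw [nextState_stay _ _ _ _ _ hb hth]
        simp [hB, a2]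
    | true =>
      have a3 := ih3 hb
      rcases lt_or_ge (s.1.pos + 1) (blockSize K T lam) with h2 | h2
      · rw [nextState_inside _ _ _ _ _ hb h2]
        refine ⟨by simp, h2, fun _ => ?_, ?_, ?_⟩
        · simp only; omega
        · simp only; linarith
        · simp only; push_cast; linarith
      · rw [nextState_block_end _ _ _ _ _ hb h2]
        refine ⟨by simp, hB, fun _ => ?_, le_rfl, by simp⟩
        simp only [mul_add]; omega

theorem measurable_run_control {K : ℕ} [NeZero K] {β : Type*} [MeasurableSpace β] (T : ℕ) (lam : ℝ)
    (t : ℕ) (f : Control K → β) : Measurable fun h : History K t => f (run T lam t h).1 :=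
  (Measurable.of_discrete (f := f)).comp (measurable_fst.comp (measurable_run T lam t))

/-! ### Resampling the arm of the current block -/

/-- The vector of the losses of all arms accumulated in the current block; zero between blocks and
in the first phase. -/
noncomputable def blockLoss {K : ℕ} [NeZero K] (T : ℕ) (lam : ℝ) :
    (t : ℕ) → History K t → Fin K → ℝ
  | 0, _ => 0
  | t + 1, h => if (run T lam (t + 1) h).1.pos = 0 then 0
      else fun i => blockLoss T lam t (Fin.init h) i + (h (Fin.last t)).2 i

/-- The history with the arms of the current block replaced by `j`; unchanged between blocks and in
the first phase. -/
noncomputable def swapArm {K : ℕ} [NeZero K] (T : ℕ) (lam : ℝ) (j : Fin K) :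
    (t : ℕ) → History K t → History K t
  | 0, h => h
  | t + 1, h => if (run T lam (t + 1) h).1.pos = 0 then h
      else Fin.snoc (swapArm T lam j t (Fin.init h)) (j, (h (Fin.last t)).2)

theorem swapArm_of_pos_eq_zero {K : ℕ} [NeZero K] {T : ℕ} {lam : ℝ} (j : Fin K) {t : ℕ}
    {h : History K t} (h0 : (run T lam t h).1.pos = 0) : swapArm T lam j t h = h := by
  cases t with
  | zero => rfl
  | succ t => simp only [swapArm, if_pos h0]

theorem blockLoss_of_pos_eq_zero {K : ℕ} [NeZero K] {T : ℕ} {lam : ℝ} {t : ℕ}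
    {h : History K t} (h0 : (run T lam t h).1.pos = 0) : blockLoss T lam t h = 0 := by
  cases t with
  | zero => rfl
  | succ t => simp only [blockLoss, if_pos h0]

theorem blockLoss_bounds {K : ℕ} [NeZero K] (T : ℕ) (lam : ℝ) (t : ℕ) (h : History K t)
    (i : Fin K) :
    0 ≤ blockLoss T lam t h i ∧ blockLoss T lam t h i ≤ (run T lam t h).1.pos := by
  induction t with
  | zero => simp [blockLoss]
  | succ t ih =>
    by_cases h0 : (run T lam (t + 1) h).1.pos = 0
    · simp [blockLoss_of_pos_eq_zero h0]
    · have hx := ((h (Fin.last t)).2 i).2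
      obtain ⟨ih1, ih2⟩ := ih (Fin.init h)
      rw [blockLoss, if_neg h0]
      rw [run_succ, nextState_pos] at h0 ⊢
      split_ifs at h0 ⊢
      · push_cast
        constructor <;> linarith [hx.1, hx.2]
      · exact absurd rfl h0

/-- Replacing the arm of the current block leaves the memory as it is, except for the number of
switches, the last arm and the accumulated loss; and the environment cannot see it. -/
theorem swapArm_spec {K : ℕ} [NeZero K] (T : ℕ) (lam : ℝ) (j : Fin K) (t : ℕ) (h : History K t) :
    (run T lam t (swapArm T lam j t h)).1.inBlocks = (run T lam t h).1.inBlocks ∧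
    (run T lam t (swapArm T lam j t h)).1.updates = (run T lam t h).1.updates ∧
    (run T lam t (swapArm T lam j t h)).1.pos = (run T lam t h).1.pos ∧
    (run T lam t (swapArm T lam j t h)).2.1 = (run T lam t h).2.1 ∧
    blockLoss T lam t (swapArm T lam j t h) = blockLoss T lam t h ∧
    (0 < (run T lam t h).1.pos →
      (run T lam t (swapArm T lam j t h)).1.last = some j ∧
      (run T lam t (swapArm T lam j t h)).2.2 = blockLoss T lam t h j) ∧
    (∀ r, (h r).2 = (swapArm T lam j t h r).2) ∧
    (∀ r : Fin t, (r : ℕ) + (run T lam t h).1.pos < t → (h r).1 = (swapArm T lam j t h r).1) := by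
  induction t with
  | zero => simp [swapArm, run, initState]
  | succ t ih =>
    by_cases h0 : (run T lam (t + 1) h).1.pos = 0
    · simp [swapArm_of_pos_eq_zero j h0, h0]
    obtain ⟨i1, i2, i3, i4, i5, i6, i7, i8⟩ := ih (Fin.init h)
    have hrun := run_succ T lam t h
    have hsw : swapArm T lam j (t + 1) h
        = Fin.snoc (swapArm T lam j t (Fin.init h)) (j, (h (Fin.last t)).2) := by
      rw [swapArm, if_neg h0]
    have hbl : blockLoss T lam (t + 1) h
        = fun i => blockLoss T lam t (Fin.init h) i + (h (Fin.last t)).2 i := by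
      rw [blockLoss, if_neg h0]
    have hcond : (run T lam t (Fin.init h)).1.inBlocks = true ∧
        (run T lam t (Fin.init h)).1.pos + 1 < blockSize K T lam := by
      by_contra hc
      rw [hrun, nextState_pos, if_neg hc] at h0
      exact h0 rfl
    obtain ⟨c1, c2⟩ := hcond
    have hrun' := run_snoc T lam t (swapArm T lam j t (Fin.init h)) (j, (h (Fin.last t)).2)
    rw [nextState_inside _ _ _ _ _ c1 c2] at hrun
    rw [nextState_inside _ _ _ _ _ (i1.trans c1) (by rw [i3]; exact c2)] at hrun'
    have hacc : (run T lam t (swapArm T lam j t (Fin.init h))).2.2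
        = blockLoss T lam t (Fin.init h) j := by
      rcases Nat.eq_zero_or_pos (run T lam t (Fin.init h)).1.pos with hz | hz
      · rw [swapArm_of_pos_eq_zero j hz, blockLoss_of_pos_eq_zero hz]
        obtain ⟨-, -, -, b4, b5⟩ := run_bounds (by omega : 0 < blockSize K T lam) t (Fin.init h)
        rw [hz, Nat.cast_zero] at b5
        exact le_antisymm b5 b4
      · exact (i6 hz).2
    rw [hsw, hrun', hrun]
    refine ⟨rfl, i2, by simp only [i3], i4, ?_, fun _ => ⟨rfl, ?_⟩, ?_, ?_⟩
    · rw [hbl, blockLoss, if_neg (by rw [hrun']; simp), Fin.init_snoc, i5, Fin.snoc_last]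
    · simp only [hacc, hbl]
    · intro r
      refine Fin.lastCases ?_ (fun r => ?_) r
      · rw [Fin.snoc_last]
      · rw [Fin.snoc_castSucc]; exact i7 r
    · intro r
      refine Fin.lastCases ?_ (fun r => ?_) r
      · intro hr; simp only [Fin.val_last] at hr; omega
      · intro hr
        rw [Fin.snoc_castSucc]
        exact i8 r (by simp only [Fin.val_castSucc] at hr; omega)

theorem stateWeights_swapArm {K : ℕ} [NeZero K] (T : ℕ) (lam : ℝ) (j : Fin K) (t : ℕ)
    (h : History K t) :
    stateWeights (run T lam t (swapArm T lam j t h)) = stateWeights (run T lam t h) := by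
  obtain ⟨-, i2, -, i4, -⟩ := swapArm_spec T lam j t h
  unfold stateWeights
  rw [i2, i4]

theorem armProb_of_pos_eq_zero {K : ℕ} [NeZero K] {s : State K} (h : s.1.pos = 0) :
    armProb s = stateWeights s := by
  unfold armProb
  rw [h]

theorem armProb_of_pos {K : ℕ} [NeZero K] {s : State K} {j : Fin K} (h : 0 < s.1.pos)
    (hj : s.1.last = some j) : armProb s = Pi.single j 1 := by
  unfold armProb
  rw [hj]
  obtain ⟨n, hn⟩ := Nat.exists_eq_succ_of_ne_zero h.ne'
  rw [hn]

theorem lossKernel_swapArm {K : ℕ} [NeZero K] {T : ℕ} {lam : ℝ} {env : Environment K}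
    (hr : env.ReactsOnlyToFinishedBlocks T lam) (j : Fin K) (t : ℕ) (h : History K t) :
    env.lossKernel t (swapArm T lam j t h) = env.lossKernel t h := by
  obtain ⟨-, -, -, -, -, -, i7, i8⟩ := swapArm_spec T lam j t h
  exact (hr t h _ i7 i8).symm

theorem measurable_swapArm {K : ℕ} [NeZero K] (T : ℕ) (lam : ℝ) (j : Fin K) (t : ℕ) :
    Measurable (swapArm T lam j t) := by
  induction t with
  | zero => exact measurable_id
  | succ t ih =>
    refine Measurable.ite (measurable_run_control T lam (t + 1)
      (fun c => c.pos) (measurableSet_singleton 0)) measurable_id ?_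
    exact (measurable_snoc K t).comp ((ih.comp (measurable_init K t)).prodMk
      (measurable_const.prodMk (measurable_snd.comp (measurable_pi_apply _))))

theorem measurable_blockLoss {K : ℕ} [NeZero K] (T : ℕ) (lam : ℝ) (t : ℕ) :
    Measurable (blockLoss (K := K) T lam t) := by
  induction t with
  | zero => exact measurable_const
  | succ t ih =>
    refine Measurable.ite (measurable_run_control T lam (t + 1)
      (fun c => c.pos) (measurableSet_singleton 0)) measurable_const ?_
    refine measurable_pi_iff.mpr fun i => ?_
    exact ((measurable_pi_apply i).comp (ih.comp (measurable_init K t))).add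
      (measurable_subtype_coe.comp ((measurable_pi_apply i).comp
        (measurable_snd.comp (measurable_pi_apply _))))

/-- The conditional expectation of `F` over the next round. -/
noncomputable def nextMean {K : ℕ} [NeZero K] (T : ℕ) (lam : ℝ) (env : Environment K) (t : ℕ)
    (F : History K (t + 1) → ℝ≥0∞) (h : History K t) : ℝ≥0∞ :=
  ∫⁻ l, ∑ i, ENNReal.ofReal (armProb (run T lam t h) i) * F (Fin.snoc h (i, l))
    ∂(env.lossKernel t h)

theorem measurable_nextMean {K : ℕ} [NeZero K] (T : ℕ) (lam : ℝ) (env : Environment K) (t : ℕ)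
    {F : History K (t + 1) → ℝ≥0∞} (hF : Measurable F) :
    Measurable (nextMean T lam env t F) := by
  unfold nextMean
  refine Measurable.lintegral_kernel_prod_right' (κ := env.lossKernel t)
    (f := fun x : History K t × Loss K => ∑ i, ENNReal.ofReal (armProb (run T lam t x.1) i) *
      F (Fin.snoc x.1 (i, x.2))) ?_
  refine Finset.measurable_sum _ fun i _ => ?_
  refine Measurable.mul ?_ ?_
  · exact ENNReal.measurable_ofReal.comp ((measurable_armProb_run T lam t i).comp measurable_fst)
  · exact hF.comp ((measurable_snoc K t).comp
      (measurable_fst.prodMk (measurable_const.prodMk measurable_snd)))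

theorem swapArm_snoc {K : ℕ} [NeZero K] {T : ℕ} {lam : ℝ} (j : Fin K) {t : ℕ} {h : History K t}
    (x : Step K) (h1 : (run T lam t h).1.inBlocks = true)
    (h2 : (run T lam t h).1.pos + 1 < blockSize K T lam) :
    swapArm T lam j (t + 1) (Fin.snoc h x) = Fin.snoc (swapArm T lam j t h) (j, x.2) := by
  rw [swapArm, if_neg, Fin.init_snoc, Fin.snoc_last]
  rw [run_snoc, nextState_pos, if_pos ⟨h1, h2⟩]
  simp

/-- The law of the history does not change when the arm of the current block is drawn anew: inside
a block, the losses and the arm are independent given the rounds before the block. -/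
theorem lintegral_swapArm {K : ℕ} [NeZero K] {T : ℕ} {lam : ℝ} {env : Environment K}
    (hr : env.ReactsOnlyToFinishedBlocks T lam) (t : ℕ)
    {F : History K t → ℝ≥0∞} (hF : Measurable F) :
    ∫⁻ h, F h ∂(gameLaw T lam env t)
      = ∫⁻ h, ∑ j, ENNReal.ofReal (stateWeights (run T lam t h) j) * F (swapArm T lam j t h)
          ∂(gameLaw T lam env t) := by
  induction t with
  | zero =>
    refine lintegral_congr fun h => ?_
    simp only [swapArm, ← Finset.sum_mul, sum_ofReal_eq_one (stateWeights_mem _), one_mul]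
  | succ t ih =>
    set H : History K (t + 1) → ℝ≥0∞ := fun h => ∑ j,
      ENNReal.ofReal (stateWeights (run T lam (t + 1) h) j) * F (swapArm T lam j (t + 1) h) with hH
    have hHm : Measurable H := by
      refine Finset.measurable_sum _ fun j _ => Measurable.mul ?_ ?_
      · exact ENNReal.measurable_ofReal.comp (measurable_stateWeights_run T lam (t + 1) j)
      · exact hF.comp (measurable_swapArm T lam j (t + 1))
    rw [lintegral_gameLaw_succ T lam env t hF, lintegral_gameLaw_succ T lam env t hHm]
    -- `P` singles out the histories after which the current block goes on.
    set P : Control K → Prop := fun c => c.inBlocks = true ∧ c.pos + 1 < blockSize K T lam with hP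
    classical
    set ind : Control K → ℝ≥0∞ := fun c => if P c then 1 else 0 with hind
    have hindm : Measurable fun h : History K t => ind (run T lam t h).1 :=
      measurable_run_control T lam t ind
    have hGm := measurable_nextMean T lam env t hF
    have hsplit : ∀ h : History K t, nextMean T lam env t H h
        = (1 - ind (run T lam t h).1) * nextMean T lam env t F h
          + ∑ j, ENNReal.ofReal (stateWeights (run T lam t h) j) *
            (ind (run T lam t (swapArm T lam j t h)).1
              * nextMean T lam env t F (swapArm T lam j t h)) := by
      intro h
      have hind' : ∀ j, ind (run T lam t (swapArm T lam j t h)).1 = ind (run T lam t h).1 := by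
        intro j
        obtain ⟨i1, -, i3, -⟩ := swapArm_spec T lam j t h
        simp only [hind, hP, i1, i3]
      by_cases hp : P (run T lam t h).1
      -- The block goes on: one round from the resampled history is the resampled next history,
      -- since the environment does not see the arm and the sampling distribution is unchanged.
      · have hone : ind (run T lam t h).1 = 1 := if_pos hp
        have hw : ∀ x : Step K, stateWeights (run T lam (t + 1) (Fin.snoc h x))
            = stateWeights (run T lam t h) := fun x => by
          rw [run_snoc, nextState_inside _ _ _ _ _ hp.1 hp.2]
          rfl
        have hG : ∀ l, ∑ i, ENNReal.ofReal (armProb (run T lam t h) i) * H (Fin.snoc h (i, l))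
            = ∑ j, ENNReal.ofReal (stateWeights (run T lam t h) j)
              * F (Fin.snoc (swapArm T lam j t h) (j, l)) := by
          intro l
          have e : ∀ i, H (Fin.snoc h (i, l)) = ∑ j, ENNReal.ofReal (stateWeights (run T lam t h) j)
              * F (Fin.snoc (swapArm T lam j t h) (j, l)) := fun i => by
            simp only [hH, hw, swapArm_snoc _ _ hp.1 hp.2]
          simp only [e, ← Finset.sum_mul, sum_ofReal_eq_one (armProb_mem _), one_mul]
        have hmeas : ∀ j, Measurable fun l : Loss K =>
            F (Fin.snoc (swapArm T lam j t h) (j, l) : History K (t + 1)) := fun j =>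
          hF.comp ((measurable_snoc K t).comp
            (measurable_const.prodMk (measurable_const.prodMk measurable_id)))
        simp only [hind', hone, tsub_self, zero_mul, zero_add, one_mul]
        simp only [nextMean, hG, lossKernel_swapArm hr]
        rcases Nat.eq_zero_or_pos (run T lam t h).1.pos with hz | hz
        · simp only [swapArm_of_pos_eq_zero _ hz, armProb_of_pos_eq_zero hz]
          rw [← Finset.sum_mul, sum_ofReal_eq_one (stateWeights_mem _), one_mul]
        · rw [lintegral_finsetSum _ fun j _ => (hmeas j).const_mul _]
          refine Finset.sum_congr rfl fun j _ => ?_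
          rw [lintegral_const_mul _ (hmeas j)]
          obtain ⟨-, -, i3, -, -, i6, -⟩ := swapArm_spec T lam j t h
          rw [armProb_of_pos (by rw [i3]; exact hz) (i6 hz).1]
          congr 1
          refine lintegral_congr fun l => ?_
          rw [Finset.sum_eq_single j]
          · simp
          · intro i _ hij
            simp [hij]
          · simp
      -- No block is under way after the next round, and there is nothing to resample.
      · have hzero : ind (run T lam t h).1 = 0 := if_neg hp
        simp only [hind', hzero, tsub_zero, one_mul, zero_mul, mul_zero, Finset.sum_const_zero,
          add_zero]
        have e : ∀ x, H (Fin.snoc h x) = F (Fin.snoc h x) := by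
          intro x
          have hz : (run T lam (t + 1) (Fin.snoc h x)).1.pos = 0 := by
            rw [run_snoc, nextState_pos, if_neg hp]
          simp only [hH, swapArm_of_pos_eq_zero _ hz]
          rw [← Finset.sum_mul, sum_ofReal_eq_one (stateWeights_mem _), one_mul]
        simp only [nextMean, e]
    have hL : ∀ h : History K t, nextMean T lam env t F h
        = (1 - ind (run T lam t h).1) * nextMean T lam env t F h
          + ind (run T lam t h).1 * nextMean T lam env t F h := by
      intro h
      by_cases hp : P (run T lam t h).1 <;> simp [hind, hp]
    have hih := ih (F := fun h => ind (run T lam t h).1 * nextMean T lam env t F h)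
      (hindm.mul hGm)
    change ∫⁻ h, nextMean T lam env t F h ∂_ = ∫⁻ h, nextMean T lam env t H h ∂_
    rw [lintegral_congr hL, lintegral_congr hsplit, lintegral_add_left, lintegral_add_left, hih]
    all_goals exact (measurable_const.sub hindm).mul hGm

/-- One round of the game, with the arm of the current block drawn anew. -/
theorem lintegral_gameLaw_succ_swapArm {K : ℕ} [NeZero K] {T : ℕ} {lam : ℝ} {env : Environment K}
    (hr : env.ReactsOnlyToFinishedBlocks T lam) (t : ℕ)
    {F : History K (t + 1) → ℝ≥0∞} (hF : Measurable F) :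
    ∫⁻ h, F h ∂(gameLaw T lam env (t + 1))
      = ∫⁻ h, ∫⁻ l, ∑ j, ENNReal.ofReal (stateWeights (run T lam t h) j) *
          ∑ i, ENNReal.ofReal (armProb (run T lam t (swapArm T lam j t h)) i)
            * F (Fin.snoc (swapArm T lam j t h) (i, l))
          ∂(env.lossKernel t h) ∂(gameLaw T lam env t) := by
  have hm : ∀ (g : History K t) (i : Fin K), Measurable fun l : Loss K =>
      F (Fin.snoc g (i, l) : History K (t + 1)) := fun g i =>
    hF.comp ((measurable_snoc K t).comp
      (measurable_const.prodMk (measurable_const.prodMk measurable_id)))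
  rw [lintegral_gameLaw_succ T lam env t hF]
  change ∫⁻ h, nextMean T lam env t F h ∂_ = _
  rw [lintegral_swapArm hr t (measurable_nextMean T lam env t hF)]
  refine lintegral_congr fun h => ?_
  have hm' : ∀ j, Measurable fun l : Loss K =>
      ∑ i, ENNReal.ofReal (armProb (run T lam t (swapArm T lam j t h)) i)
        * F (Fin.snoc (swapArm T lam j t h) (i, l)) := fun j =>
    Finset.measurable_sum _ fun i _ => (hm _ i).const_mul _
  rw [lintegral_finsetSum _ fun j _ => (hm' j).const_mul _]
  refine Finset.sum_congr rfl fun j _ => ?_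
  rw [lintegral_const_mul _ (hm' j), nextMean, lossKernel_swapArm hr]

/-! ### Accumulated costs -/

/-- The cost of a round, as a function of the number of earlier rounds, of the past and of what
happens in the round. -/
abbrev Cost (K : ℕ) : Type := (t : ℕ) → History K t → Step K → ℝ

/-- The sum of the costs of the first `t` rounds. -/
def cum {K : ℕ} (f : Cost K) : (t : ℕ) → History K t → ℝ
  | 0, _ => 0
  | t + 1, h => cum f t (Fin.init h) + f t (Fin.init h) (h (Fin.last t))

/-- A measurable cost, bounded uniformly over all rounds. -/
def Cost.IsBounded {K : ℕ} (f : Cost K) : Prop :=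
  (∀ t, Measurable fun x : History K t × Step K => f t x.1 x.2) ∧ ∃ C, ∀ t h x, |f t h x| ≤ C

theorem Cost.IsBounded.add {K : ℕ} {f g : Cost K} (hf : f.IsBounded) (hg : g.IsBounded) :
    Cost.IsBounded (f + g) := by
  obtain ⟨hf, C, hC⟩ := hf
  obtain ⟨hg, D, hD⟩ := hg
  exact ⟨fun t => (hf t).add (hg t), C + D, fun t h x =>
    (abs_add_le _ _).trans (add_le_add (hC t h x) (hD t h x))⟩

theorem Cost.IsBounded.smul {K : ℕ} {f : Cost K} (hf : f.IsBounded) (c : ℝ) :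
    Cost.IsBounded (c • f) := by
  obtain ⟨hf, C, hC⟩ := hf
  refine ⟨fun t => (hf t).const_mul c, |c| * C, fun t h x => ?_⟩
  simp only [Pi.smul_apply, smul_eq_mul, abs_mul]
  exact mul_le_mul_of_nonneg_left (hC t h x) (abs_nonneg c)

theorem cum_add {K : ℕ} (f g : Cost K) (t : ℕ) (h : History K t) :
    cum (f + g) t h = cum f t h + cum g t h := by
  induction t with
  | zero => simp [cum]
  | succ t ih => simp only [cum, ih, Pi.add_apply]; ring

theorem cum_smul {K : ℕ} (c : ℝ) (f : Cost K) (t : ℕ) (h : History K t) :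
    cum (c • f) t h = c * cum f t h := by
  induction t with
  | zero => simp [cum]
  | succ t ih => simp only [cum, ih, Pi.smul_apply, smul_eq_mul]; ring

theorem cum_mono {K : ℕ} {f g : Cost K} (hfg : ∀ t h x, f t h x ≤ g t h x) (t : ℕ)
    (h : History K t) : cum f t h ≤ cum g t h := by
  induction t with
  | zero => simp [cum]
  | succ t ih => exact add_le_add (ih _) (hfg _ _ _)

theorem cum_nonneg {K : ℕ} {f : Cost K} (hf : ∀ t h x, 0 ≤ f t h x) (t : ℕ)
    (h : History K t) : 0 ≤ cum f t h := by
  induction t with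
  | zero => simp [cum]
  | succ t ih => exact add_nonneg (ih _) (hf _ _ _)

theorem cum_eq_sum {K : ℕ} (f : ℕ → Step K → ℝ) (t : ℕ) (h : History K t) :
    cum (fun t _ x => f t x) t h = ∑ r : Fin t, f r (h r) := by
  induction t with
  | zero => simp [cum]
  | succ t ih =>
    rw [Fin.sum_univ_castSucc, cum, ih]
    rfl

theorem measurable_cum {K : ℕ} {f : Cost K} (hf : f.IsBounded) (t : ℕ) : Measurable (cum f t) := by
  induction t with
  | zero => exact measurable_const
  | succ t ih =>
    exact (ih.comp (measurable_init K t)).add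
      ((hf.1 t).comp ((measurable_init K t).prodMk (measurable_pi_apply _)))

theorem measurable_cost_last {K : ℕ} {f : Cost K} (hf : f.IsBounded) (t : ℕ) :
    Measurable fun h : History K (t + 1) => f t (Fin.init h) (h (Fin.last t)) :=
  (hf.1 t).comp ((measurable_init K t).prodMk (measurable_pi_apply _))

theorem exists_abs_cum_le {K : ℕ} {f : Cost K} (hf : f.IsBounded) (t : ℕ) :
    ∃ C, ∀ h, |cum f t h| ≤ C := by
  obtain ⟨-, C, hC⟩ := hf
  induction t with
  | zero => exact ⟨0, fun h => by simp [cum]⟩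
  | succ t ih =>
    obtain ⟨D, hD⟩ := ih
    exact ⟨D + C, fun h => (abs_add_le _ _).trans (add_le_add (hD _) (hC _ _ _))⟩

theorem integrable_cum {K : ℕ} {f : Cost K} (hf : f.IsBounded) (t : ℕ)
    (μ : Measure (History K t)) [IsFiniteMeasure μ] : Integrable (cum f t) μ := by
  obtain ⟨C, hC⟩ := exists_abs_cum_le hf t
  exact Integrable.of_bound (measurable_cum hf t).aestronglyMeasurable C
    (Filter.Eventually.of_forall hC)

theorem integral_cum_succ {K : ℕ} [NeZero K] (T : ℕ) (lam : ℝ) (env : Environment K)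
    {f : Cost K} (hf : f.IsBounded) (t : ℕ) :
    ∫ h, cum f (t + 1) h ∂(gameLaw T lam env (t + 1))
      = ∫ h, cum f t h ∂(gameLaw T lam env t)
        + ∫ h, ∑ i, armProb (run T lam t h) i * ∫ l, f t h (i, l)
          ∂(env.lossKernel t h) ∂(gameLaw T lam env t) := by
  obtain ⟨C, hC⟩ := hf.2
  have hm := measurable_cost_last hf t
  have h1 : Integrable (fun h : History K (t + 1) => cum f t (Fin.init h))
      (gameLaw T lam env (t + 1)) :=
    (map_init_gameLaw T lam env t).integrable_comp_of_integrable (integrable_cum hf t _)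
  simp only [cum]
  rw [integral_add h1, integral_gameLaw_succ T lam env t hm fun h => hC _ _ _]
  · simp only [Fin.init_snoc, Fin.snoc_last]
    congr 1
    have e := (map_init_gameLaw T lam env t).map_eq
    conv_rhs => rw [← e]
    rw [integral_map (measurable_init K t).aemeasurable (measurable_cum hf t).aestronglyMeasurable]
  · exact Integrable.of_bound hm.aestronglyMeasurable C
      (Filter.Eventually.of_forall fun h => hC _ _ _)

/-- Comparing the conditional means of two costs round by round compares their expected sums. -/
theorem integral_cum_le_of_mean_le {K : ℕ} [NeZero K] (T : ℕ) (lam : ℝ) (env : Environment K)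
    {f g : Cost K} (hf : f.IsBounded) (hg : g.IsBounded)
    (hfg : ∀ t h, ∑ i, armProb (run T lam t h) i * ∫ l, f t h (i, l) ∂(env.lossKernel t h)
      ≤ ∑ i, armProb (run T lam t h) i * ∫ l, g t h (i, l) ∂(env.lossKernel t h)) (t : ℕ) :
    ∫ h, cum f t h ∂(gameLaw T lam env t) ≤ ∫ h, cum g t h ∂(gameLaw T lam env t) := by
  have hI : ∀ {f : Cost K}, f.IsBounded → ∀ t, Integrable (fun h => ∑ i,
      armProb (run T lam t h) i * ∫ l, f t h (i, l) ∂(env.lossKernel t h))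
      (gameLaw T lam env t) := by
    intro f hf t
    obtain ⟨hfm, C, hC⟩ := hf
    refine integrable_finsetSum _ fun i _ => ?_
    have hm : StronglyMeasurable fun h : History K t =>
        ∫ l, f t h (i, l) ∂(env.lossKernel t h) := by
      refine StronglyMeasurable.integral_kernel_prod_right' (κ := env.lossKernel t)
        (f := fun x : History K t × Loss K => f t x.1 (i, x.2)) ?_
      exact ((hfm t).comp (measurable_fst.prodMk
        (measurable_const.prodMk measurable_snd))).stronglyMeasurable
    refine Integrable.of_bound (C := C)
      ((measurable_armProb_run T lam t i).mul hm.measurable).aestronglyMeasurable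
      (Filter.Eventually.of_forall fun h => ?_)
    have h1 := armProb_mem (run T lam t h)
    have h2 : armProb (run T lam t h) i ≤ 1 :=
      h1.2 ▸ Finset.single_le_sum (fun i _ => h1.1 i) (Finset.mem_univ i)
    have h3 : ‖∫ l, f t h (i, l) ∂(env.lossKernel t h)‖ ≤ C := by
      have := norm_integral_le_of_norm_le_const (μ := env.lossKernel t h)
        (f := fun l => f t h (i, l)) (C := C) (Filter.Eventually.of_forall fun l => hC _ _ _)
      simpa using this
    rw [norm_mul, Real.norm_of_nonneg (h1.1 i)]
    have := norm_nonneg (∫ l, f t h (i, l) ∂(env.lossKernel t h))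
    nlinarith [h1.1 i]
  induction t with
  | zero => simp [cum]
  | succ t ih =>
    rw [integral_cum_succ T lam env hf, integral_cum_succ T lam env hg]
    exact add_le_add ih (integral_mono (hI hf t) (hI hg t) fun h => hfg t h)

/-- The conditional mean of `F`, given the past `h` and the loss vector `l` of the next round,
when the arm of the current block is drawn anew. -/
noncomputable def armMean {K : ℕ} [NeZero K] (T : ℕ) (lam : ℝ) {t : ℕ} (h : History K t)
    (F : History K t → Fin K → ℝ) : ℝ :=
  ∑ j, stateWeights (run T lam t h) j *
    ∑ i, armProb (run T lam t (swapArm T lam j t h)) i * F (swapArm T lam j t h) i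

theorem lintegral_le_of_armMean_le {K : ℕ} [NeZero K] {T : ℕ} {lam : ℝ} {env : Environment K}
    (hr : env.ReactsOnlyToFinishedBlocks T lam) (t : ℕ) {F G : History K (t + 1) → ℝ}
    (hF : Measurable F) (hG : Measurable G) (hF0 : ∀ h, 0 ≤ F h) (hG0 : ∀ h, 0 ≤ G h)
    (hFG : ∀ h l, armMean T lam h (fun h i => F (Fin.snoc h (i, l)))
      ≤ armMean T lam h (fun h i => G (Fin.snoc h (i, l)))) :
    ∫⁻ h, ENNReal.ofReal (F h) ∂(gameLaw T lam env (t + 1))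
      ≤ ∫⁻ h, ENNReal.ofReal (G h) ∂(gameLaw T lam env (t + 1)) := by
  have key : ∀ {F : History K (t + 1) → ℝ}, (∀ h, 0 ≤ F h) → ∀ h l,
      ∑ j, ENNReal.ofReal (stateWeights (run T lam t h) j) *
          ∑ i, ENNReal.ofReal (armProb (run T lam t (swapArm T lam j t h)) i)
            * ENNReal.ofReal (F (Fin.snoc (swapArm T lam j t h) (i, l)))
        = ENNReal.ofReal (armMean T lam h (fun h i => F (Fin.snoc h (i, l)))) := by
    intro F hF0 h l
    have hp : ∀ j i, 0 ≤ armProb (run T lam t (swapArm T lam j t h)) i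
        * F (Fin.snoc (swapArm T lam j t h) (i, l)) := fun j i =>
      mul_nonneg ((armProb_mem _).1 i) (hF0 _)
    rw [armMean, ENNReal.ofReal_sum_of_nonneg fun j _ =>
      mul_nonneg ((stateWeights_mem _).1 j) (Finset.sum_nonneg fun i _ => hp j i)]
    refine Finset.sum_congr rfl fun j _ => ?_
    rw [ENNReal.ofReal_mul ((stateWeights_mem _).1 j),
      ENNReal.ofReal_sum_of_nonneg fun i _ => hp j i]
    congr 1
    refine Finset.sum_congr rfl fun i _ => ?_
    rw [ENNReal.ofReal_mul ((armProb_mem _).1 i)]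
  rw [lintegral_gameLaw_succ_swapArm hr t hF.ennreal_ofReal,
    lintegral_gameLaw_succ_swapArm hr t hG.ennreal_ofReal]
  refine lintegral_mono fun h => lintegral_mono fun l => ?_
  rw [key hF0, key hG0]
  exact ENNReal.ofReal_le_ofReal (hFG h l)

/-- The potential argument: a nonnegative potential `Q`, zero at the start, pays for the difference
of the costs `f` and `g` in conditional mean. Integrability of `Q` is not assumed. -/
theorem integral_cum_le_of_potential {K : ℕ} [NeZero K] {T : ℕ} {lam : ℝ} {env : Environment K}
    (hr : env.ReactsOnlyToFinishedBlocks T lam) {f g : Cost K} (hf : f.IsBounded)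
    (hg : g.IsBounded) (hf0 : ∀ t h x, 0 ≤ f t h x) (hg0 : ∀ t h x, 0 ≤ g t h x)
    (Q : (t : ℕ) → History K t → ℝ) (hQ : ∀ t, Measurable (Q t)) (hQ0 : ∀ h, Q 0 h = 0)
    (hQnn : ∀ t ≤ T, ∀ h, 0 ≤ Q t h)
    (hstep : ∀ t < T, ∀ h l,
      armMean T lam h (fun h i => f t h (i, l) + Q (t + 1) (Fin.snoc h (i, l)))
      ≤ armMean T lam h (fun h i => g t h (i, l) + Q t h)) :
    ∫ h, cum f T h ∂(gameLaw T lam env T) ≤ ∫ h, cum g T h ∂(gameLaw T lam env T) := by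
  have key : ∀ t ≤ T, ∫⁻ h, ENNReal.ofReal (cum f t h) + ENNReal.ofReal (Q t h)
        ∂(gameLaw T lam env t) ≤ ∫⁻ h, ENNReal.ofReal (cum g t h) ∂(gameLaw T lam env t) := by
    intro t
    induction t with
    | zero => intro _; simp [cum, hQ0]
    | succ t ih =>
      intro ht
      have hmf := measurable_cost_last hf t
      have hmg := measurable_cost_last hg t
      have hmQ : Measurable fun h : History K (t + 1) => Q t (Fin.init h) :=
        (hQ t).comp (measurable_init K t)
      have hcf : Measurable fun h : History K (t + 1) => ENNReal.ofReal (cum f t (Fin.init h)) :=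
        ENNReal.measurable_ofReal.comp ((measurable_cum hf t).comp (measurable_init K t))
      have hcg : Measurable fun h : History K (t + 1) => ENNReal.ofReal (cum g t (Fin.init h)) :=
        ENNReal.measurable_ofReal.comp ((measurable_cum hg t).comp (measurable_init K t))
      have h1 := lintegral_le_of_armMean_le hr t (hmf.add (hQ (t + 1))) (hmg.add hmQ)
        (fun h => add_nonneg (hf0 _ _ _) (hQnn _ ht _))
        (fun h => add_nonneg (hg0 _ _ _) (hQnn _ (by omega) _))
        (fun h l => by
          simp only [Pi.add_apply, Fin.init_snoc, Fin.snoc_last]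
          exact hstep t (by omega) h l)
      have h2 := (map_init_gameLaw T lam env t).lintegral_comp
        (f := fun h => ENNReal.ofReal (cum f t h) + ENNReal.ofReal (Q t h))
        ((ENNReal.measurable_ofReal.comp (measurable_cum hf t)).add
          (ENNReal.measurable_ofReal.comp (hQ t)))
      have h3 := (map_init_gameLaw T lam env t).lintegral_comp
        (f := fun h => ENNReal.ofReal (cum g t h))
        (ENNReal.measurable_ofReal.comp (measurable_cum hg t))
      calc ∫⁻ h, ENNReal.ofReal (cum f (t + 1) h) + ENNReal.ofReal (Q (t + 1) h)
            ∂(gameLaw T lam env (t + 1))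
          = ∫⁻ h, ENNReal.ofReal (cum f t (Fin.init h)) ∂(gameLaw T lam env (t + 1))
            + ∫⁻ h, ENNReal.ofReal (f t (Fin.init h) (h (Fin.last t)) + Q (t + 1) h)
              ∂(gameLaw T lam env (t + 1)) := by
            rw [← lintegral_add_left hcf]
            refine lintegral_congr fun h => ?_
            rw [cum, ENNReal.ofReal_add (cum_nonneg hf0 _ _) (hf0 _ _ _),
              ENNReal.ofReal_add (hf0 _ _ _) (hQnn _ ht _), add_assoc]
        _ ≤ ∫⁻ h, ENNReal.ofReal (cum f t (Fin.init h)) ∂(gameLaw T lam env (t + 1))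
            + ∫⁻ h, ENNReal.ofReal (g t (Fin.init h) (h (Fin.last t)) + Q t (Fin.init h))
              ∂(gameLaw T lam env (t + 1)) := by
            exact add_le_add_right h1 _
        _ = ∫⁻ h, ENNReal.ofReal (cum f t (Fin.init h)) + ENNReal.ofReal (Q t (Fin.init h))
              ∂(gameLaw T lam env (t + 1))
            + ∫⁻ h, ENNReal.ofReal (g t (Fin.init h) (h (Fin.last t)))
              ∂(gameLaw T lam env (t + 1)) := by
            have hm : Measurable fun h : History K (t + 1) =>
                ENNReal.ofReal (cum f t (Fin.init h)) + ENNReal.ofReal (Q t (Fin.init h)) :=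
              hcf.add hmQ.ennreal_ofReal
            rw [← lintegral_add_left hcf, ← lintegral_add_left hm]
            refine lintegral_congr fun h => ?_
            rw [ENNReal.ofReal_add (hg0 _ _ _) (hQnn _ (by omega) _)]
            ring
        _ ≤ ∫⁻ h, ENNReal.ofReal (cum g t (Fin.init h)) ∂(gameLaw T lam env (t + 1))
            + ∫⁻ h, ENNReal.ofReal (g t (Fin.init h) (h (Fin.last t)))
              ∂(gameLaw T lam env (t + 1)) := by
            rw [h2, h3]
            exact add_le_add_left (ih (by omega)) _
        _ = ∫⁻ h, ENNReal.ofReal (cum g (t + 1) h) ∂(gameLaw T lam env (t + 1)) := by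
            rw [← lintegral_add_left hcg]
            refine lintegral_congr fun h => ?_
            rw [cum, ENNReal.ofReal_add (cum_nonneg hg0 _ _) (hg0 _ _ _)]
  have h1 := (lintegral_mono fun h => le_self_add).trans (key T le_rfl)
  rw [← ofReal_integral_eq_lintegral_ofReal (integrable_cum hf T _)
      (Filter.Eventually.of_forall fun h => cum_nonneg hf0 _ _),
    ← ofReal_integral_eq_lintegral_ofReal (integrable_cum hg T _)
      (Filter.Eventually.of_forall fun h => cum_nonneg hg0 _ _)] at h1
  exact (ENNReal.ofReal_le_ofReal_iff (integral_nonneg fun h => cum_nonneg hg0 _ _)).1 h1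

theorem armMean_of_pos_eq_zero {K : ℕ} [NeZero K] {T : ℕ} {lam : ℝ} {t : ℕ} {h : History K t}
    (h0 : (run T lam t h).1.pos = 0) (F : History K t → Fin K → ℝ) :
    armMean T lam h F = ∑ i, stateWeights (run T lam t h) i * F h i := by
  simp only [armMean, swapArm_of_pos_eq_zero _ h0, armProb_of_pos_eq_zero h0]
  rw [← Finset.sum_mul, (stateWeights_mem _).2, one_mul]

theorem armMean_of_pos {K : ℕ} [NeZero K] {T : ℕ} {lam : ℝ} {t : ℕ} {h : History K t}
    (h0 : 0 < (run T lam t h).1.pos) (F : History K t → Fin K → ℝ) :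
    armMean T lam h F
      = ∑ j, stateWeights (run T lam t h) j * F (swapArm T lam j t h) j := by
  refine Finset.sum_congr rfl fun j _ => ?_
  obtain ⟨-, -, i3, -, -, i6, -⟩ := swapArm_spec T lam j t h
  rw [armProb_of_pos (by rw [i3]; exact h0) (i6 h0).1]
  congr 1
  rw [Finset.sum_eq_single j]
  · simp
  · intro i _ hij
    simp [hij]
  · simp

/-! ### The costs of the two phases -/

/-- The cost `f`, charged only in the rounds that the learner starts in the second phase
(`b = true`), or in the first phase (`b = false`). -/
noncomputable def inPhase {K : ℕ} [NeZero K] (T : ℕ) (lam : ℝ) (b : Bool) (f : Cost K) : Cost K :=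
  fun t h x => if (run T lam t h).1.inBlocks = b then f t h x else 0

/-- The loss of the arm that is played. -/
def playedLoss (K : ℕ) : Cost K := fun _ _ x => x.2 x.1

/-- The loss of a fixed arm. -/
def armLoss {K : ℕ} (i : Fin K) : Cost K := fun _ _ x => x.2 i

/-- The number of switches in a round. -/
noncomputable def switchCost {K : ℕ} [NeZero K] (T : ℕ) (lam : ℝ) : Cost K :=
  fun t h x => if (run T lam t h).1.last = some x.1 then 0 else 1

/-- The indicator of the round at the end of which the second phase is entered. -/
noncomputable def enterCost {K : ℕ} [NeZero K] (T : ℕ) (lam : ℝ) : Cost K :=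
  inPhase T lam false fun t h x =>
    if switchThreshold K T lam ≤ ((run T lam t h).1.switches
      + if (run T lam t h).1.last = some x.1 then 0 else 1 : ℕ) then 1 else 0

/-- The bound of `tsallis_step` on the regret of a round of the first phase. -/
noncomputable def exploration {K : ℕ} [NeZero K] (T : ℕ) (lam : ℝ) (i₀ : Fin K) : Cost K :=
  fun t h _ => 9 / √((t : ℝ) + 1) * ∑ i with i ≠ i₀, √(stateWeights (run T lam t h) i)

theorem Cost.IsBounded.inPhase {K : ℕ} [NeZero K] {f : Cost K} (hf : f.IsBounded) (T : ℕ) (lam : ℝ)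
    (b : Bool) : (inPhase T lam b f).IsBounded := by
  obtain ⟨hf, C, hC⟩ := hf
  refine ⟨fun t => Measurable.ite ?_ (hf t) measurable_const, C, fun t h x => ?_⟩
  · exact ((measurable_run_control T lam t (fun c => c.inBlocks)).comp measurable_fst)
      (measurableSet_singleton b)
  · unfold SwitchTsallis.inPhase
    split_ifs
    · exact hC t h x
    · rw [abs_zero]; exact (abs_nonneg _).trans (hC t h x)

theorem inPhase_add_inPhase {K : ℕ} [NeZero K] (T : ℕ) (lam : ℝ) (f : Cost K) :
    inPhase T lam false f + inPhase T lam true f = f := by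
  funext t h x
  simp only [inPhase, Pi.add_apply]
  cases (run T lam t h).1.inBlocks <;> simp

theorem isBounded_playedLoss (K : ℕ) : (playedLoss K).IsBounded := by
  refine ⟨fun t => ?_, 1, fun t h x => ?_⟩
  · have : Measurable fun x : Fin K × Loss K => ((x.2 x.1 : unitInterval) : ℝ) := by
      refine measurable_from_prod_countable_right fun i => ?_
      exact measurable_subtype_coe.comp (measurable_pi_apply i)
    exact this.comp measurable_snd
  · rw [playedLoss, abs_of_nonneg (x.2 x.1).2.1]; exact (x.2 x.1).2.2

theorem isBounded_armLoss {K : ℕ} (i : Fin K) : (armLoss i).IsBounded := by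
  refine ⟨fun t => ?_, 1, fun t h x => ?_⟩
  · exact measurable_subtype_coe.comp ((measurable_pi_apply i).comp
      (measurable_snd.comp measurable_snd))
  · rw [armLoss, abs_of_nonneg (x.2 i).2.1]; exact (x.2 i).2.2

theorem isBounded_of_control {K : ℕ} [NeZero K] (T : ℕ) (lam : ℝ)
    (f : Control K → Fin K → ℝ) {C : ℝ} (hC : ∀ c i, |f c i| ≤ C) :
    Cost.IsBounded (fun t h x => f (run T lam t h).1 x.1 : Cost K) := by
  refine ⟨fun t => ?_, C, fun t h x => hC _ _⟩
  have : Measurable fun c : Control K × Fin K => f c.1 c.2 := Measurable.of_discrete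
  exact this.comp (f := fun x : History K t × Step K => ((run T lam t x.1).1, x.2.1))
    (((measurable_run_control T lam t id).comp measurable_fst).prodMk
      (measurable_fst.comp measurable_snd))

theorem isBounded_switchCost {K : ℕ} [NeZero K] (T : ℕ) (lam : ℝ) :
    (switchCost (K := K) T lam).IsBounded :=
  isBounded_of_control T lam (fun c i => if c.last = some i then 0 else 1) (C := 1) fun c i => by
    split_ifs <;> simp

theorem isBounded_enterCost {K : ℕ} [NeZero K] (T : ℕ) (lam : ℝ) :
    (enterCost (K := K) T lam).IsBounded :=
  (isBounded_of_control T lam (fun c i => if switchThreshold K T lam ≤ (c.switches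
      + if c.last = some i then 0 else 1 : ℕ) then 1 else 0) (C := 1) fun c i => by
    split_ifs <;> simp).inPhase T lam false

theorem isBounded_exploration {K : ℕ} [NeZero K] (T : ℕ) (lam : ℝ) (i₀ : Fin K) :
    (exploration T lam i₀).IsBounded := by
  refine ⟨fun t => ?_, 9 * √(K : ℝ), fun t h x => ?_⟩
  · refine Measurable.const_mul (Finset.measurable_sum _ fun i _ => ?_) _
    exact ((measurable_stateWeights_run T lam t i).comp measurable_fst).sqrt
  · have h1 := sum_sqrt_ne_le (stateWeights_mem (run T lam t h)) i₀
    have h0 : 0 ≤ ∑ i with i ≠ i₀, √(stateWeights (run T lam t h) i) :=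
      Finset.sum_nonneg fun i _ => Real.sqrt_nonneg _
    have h2 : 9 / √((t : ℝ) + 1) ≤ 9 :=
      div_le_self (by norm_num) (Real.one_le_sqrt.2 (by simp))
    rw [exploration, abs_of_nonneg (by positivity)]
    gcongr

theorem playedLoss_nonneg {K t : ℕ} (h : History K t) (x : Step K) : 0 ≤ playedLoss K t h x :=
  (x.2 x.1).2.1

theorem armLoss_nonneg {K t : ℕ} (i : Fin K) (h : History K t) (x : Step K) :
    0 ≤ armLoss i t h x :=
  (x.2 i).2.1

theorem switchCost_nonneg {K : ℕ} [NeZero K] (T : ℕ) (lam : ℝ) {t : ℕ} (h : History K t)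
    (x : Step K) : 0 ≤ switchCost T lam t h x := by
  unfold switchCost; split_ifs <;> simp

theorem switchCost_le_one {K : ℕ} [NeZero K] (T : ℕ) (lam : ℝ) {t : ℕ} (h : History K t)
    (x : Step K) : switchCost T lam t h x ≤ 1 := by
  unfold switchCost; split_ifs <;> simp

theorem exploration_nonneg {K : ℕ} [NeZero K] (T : ℕ) (lam : ℝ) (i₀ : Fin K) {t : ℕ}
    (h : History K t) (x : Step K) : 0 ≤ exploration T lam i₀ t h x :=
  mul_nonneg (by positivity) (Finset.sum_nonneg fun i _ => Real.sqrt_nonneg _)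

theorem inPhase_nonneg {K : ℕ} [NeZero K] {T : ℕ} {lam : ℝ} {b : Bool} {f : Cost K}
    (hf : ∀ t h x, 0 ≤ f t h x) (t : ℕ) (h : History K t) (x : Step K) :
    0 ≤ inPhase T lam b f t h x := by
  unfold inPhase; split_ifs
  · exact hf _ _ _
  · exact le_rfl

theorem nextState_inBlocks_of_inBlocks {K : ℕ} [NeZero K] (T : ℕ) (lam : ℝ) (s : State K)
    (i : Fin K) (x : ℝ) (h : s.1.inBlocks = true) :
    (nextState T lam s i x).1.inBlocks = true := by
  rcases lt_or_ge (s.1.pos + 1) (blockSize K T lam) with h2 | h2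
  · rw [nextState_inside _ _ _ _ _ h h2]
  · rw [nextState_block_end _ _ _ _ _ h h2]

/-! ### The regret of the two phases -/

theorem measurable_leaderGap_state {K : ℕ} [NeZero K] (i₀ : Fin K) :
    Measurable fun s : State K => leaderGap i₀ s.1.updates s.2.1 := by
  refine measurable_from_prod_countable_right fun c => ?_
  exact (measurable_leaderGap i₀ c.updates).comp measurable_fst

/-- The regret of the first phase. The potential is `leaderGap`; it is dropped upon entering the
second phase, which is allowed because it is nonnegative. -/
theorem integral_playedLoss_firstPhase_le {K : ℕ} [NeZero K] {T : ℕ} {lam : ℝ}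
    {env : Environment K} (hr : env.ReactsOnlyToFinishedBlocks T lam)
    (hB : 0 < blockSize K T lam) (i₀ : Fin K) :
    ∫ h, cum (inPhase T lam false (playedLoss K)) T h ∂(gameLaw T lam env T)
      ≤ ∫ h, cum (inPhase T lam false (armLoss i₀ + exploration T lam i₀)) T h
        ∂(gameLaw T lam env T) := by
  refine integral_cum_le_of_potential hr ((isBounded_playedLoss K).inPhase T lam false)
    (((isBounded_armLoss i₀).add (isBounded_exploration T lam i₀)).inPhase T lam false)
    (inPhase_nonneg fun t h x => playedLoss_nonneg h x)
    (inPhase_nonneg fun t h x => add_nonneg (armLoss_nonneg i₀ h x)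
      (exploration_nonneg T lam i₀ h x))
    (fun t h => if (run T lam t h).1.inBlocks = false then
      leaderGap i₀ (run T lam t h).1.updates (run T lam t h).2.1 else 0) (fun t => ?_) (fun h => ?_)
    (fun t _ h => ?_) (fun t _ h l => ?_)
  · exact Measurable.ite (measurable_run_control T lam t (fun c => c.inBlocks)
      (measurableSet_singleton false))
      ((measurable_leaderGap_state i₀).comp (measurable_run T lam t)) measurable_const
  · simp [run, initState, leaderGap_zero]
  · split_ifs
    · exact leaderGap_nonneg _ _ _
    · exact le_rfl
  · obtain ⟨b1, -⟩ := run_bounds hB t h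
    cases hb : (run T lam t h).1.inBlocks with
    | true =>
      refine Finset.sum_le_sum fun j _ => mul_le_mul_of_nonneg_left
        (Finset.sum_le_sum fun i _ => mul_le_mul_of_nonneg_left ?_ ((armProb_mem _).1 i))
        ((stateWeights_mem _).1 j)
      have hb' := (swapArm_spec T lam j t h).1.trans hb
      have hb2 := nextState_inBlocks_of_inBlocks T lam _ i (l i) hb'
      simp [inPhase, hb', run_snoc, hb2]
    | false =>
      obtain ⟨hp, hu⟩ := b1 hb
      rw [armMean_of_pos_eq_zero hp, armMean_of_pos_eq_zero hp]
      simp only [inPhase, hb, if_true, run_snoc]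
      have hstep := tsallis_step i₀ (run T lam t h).1.updates (run T lam t h).2.1
        (fun i => (l i : ℝ)) (fun i => (l i).2.1) (fun i => (l i).2.2)
        (stateWeights (run T lam t h)) rfl
      have hleft : ∀ i, (playedLoss K t h (i, l)
          + if (nextState T lam (run T lam t h) i (l i)).1.inBlocks = false then
            leaderGap i₀ (nextState T lam (run T lam t h) i (l i)).1.updates
              (nextState T lam (run T lam t h) i (l i)).2.1 else 0)
          ≤ leaderGap i₀ ((run T lam t h).1.updates + 1) ((run T lam t h).2.1
            + Pi.single i ((l i : ℝ) / stateWeights (run T lam t h) i)) + l i := by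
        intro i
        by_cases hth : switchThreshold K T lam ≤ ((run T lam t h).1.switches
            + if (run T lam t h).1.last = some i then 0 else 1 : ℕ)
        · rw [nextState_enter _ _ _ _ _ hb hth]
          simp [playedLoss, leaderGap_nonneg]
        · rw [nextState_stay _ _ _ _ _ hb hth]
          simp [playedLoss, estimate, add_comm]
      refine (Finset.sum_le_sum fun i _ => mul_le_mul_of_nonneg_left (hleft i)
        ((stateWeights_mem _).1 i)).trans (hstep.trans ?_)
      simp only [armLoss, exploration, Pi.add_apply, hu]
      rw [← Finset.sum_mul, (stateWeights_mem _).2, one_mul]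
      linarith

/-- The value of the potential of the second phase upon entry. Its parts pay for the regret of
Tsallis-INF over the finished blocks, for the regret of the block that is cut off at the end, and
for the switches. -/
noncomputable def entryCost (K T : ℕ) (lam : ℝ) : ℝ :=
  18 * √(K : ℝ) * blockSize K T lam * √((T : ℝ) / blockSize K T lam) + blockSize K T lam
    + lam * ((T : ℝ) / blockSize K T lam + 1)

/-- The potential of the second phase. It consists of the potential of Tsallis-INF, the regret that
the remaining blocks may still add to it, the pending regret of the current block (shifted by the
block size to be nonnegative), and the cost of the switches that are still to come. -/
noncomputable def blockPotential {K : ℕ} [NeZero K] (T : ℕ) (lam : ℝ) (i₀ : Fin K) (t : ℕ)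
    (h : History K t) : ℝ :=
  if (run T lam t h).1.inBlocks = true then
    blockSize K T lam * leaderGap i₀ (run T lam t h).1.updates (run T lam t h).2.1
    + 18 * √(K : ℝ) * blockSize K T lam *
      (√((T : ℝ) / blockSize K T lam) - √((run T lam t h).1.updates : ℝ))
    + (blockLoss T lam t h i₀ - (run T lam t h).2.2 + blockSize K T lam)
    + lam * ((T : ℝ) / blockSize K T lam + 1 - (run T lam t h).1.updates
      - if (run T lam t h).1.pos = 0 then 0 else 1)
  else 0

theorem measurable_blockPotential {K : ℕ} [NeZero K] (T : ℕ) (lam : ℝ) (i₀ : Fin K) (t : ℕ) :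
    Measurable (blockPotential T lam i₀ t) := by
  unfold blockPotential
  refine Measurable.ite (measurable_run_control T lam t (fun c => c.inBlocks)
      (measurableSet_singleton true)) ?_ measurable_const
  refine ((Measurable.add ?_ ?_).add ?_).add ?_
  · exact ((measurable_leaderGap_state i₀).comp (measurable_run T lam t)).const_mul _
  · exact measurable_run_control T lam t (fun c => 18 * √(K : ℝ) * blockSize K T lam *
      (√((T : ℝ) / blockSize K T lam) - √(c.updates : ℝ)))
  · exact (((measurable_pi_apply i₀).comp (measurable_blockLoss T lam t)).sub
      (measurable_snd.comp (measurable_snd.comp (measurable_run T lam t)))).add measurable_const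
  · exact measurable_run_control T lam t (fun c => lam * ((T : ℝ) / blockSize K T lam + 1
      - c.updates - if c.pos = 0 then 0 else 1))

theorem blockPotential_nonneg {K : ℕ} [NeZero K] {T : ℕ} {lam : ℝ} (hlam : 0 ≤ lam)
    (hB : 0 < blockSize K T lam) (i₀ : Fin K) {t : ℕ} (ht : t ≤ T) (h : History K t) :
    0 ≤ blockPotential T lam i₀ t h := by
  unfold blockPotential
  split_ifs with hb hp
  all_goals try exact le_rfl
  all_goals
    obtain ⟨-, b2, b3, b4, b5⟩ := run_bounds hB t h
    have b3' := (b3 hb).trans ht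
    have hB' : (0 : ℝ) < blockSize K T lam := by exact_mod_cast hB
    have hu : ((run T lam t h).1.updates : ℝ) ≤ (T : ℝ) / blockSize K T lam := by
      rw [le_div_iff₀ hB', mul_comm]
      exact_mod_cast (Nat.le_add_right _ _).trans b3'
    have b2' : ((run T lam t h).1.pos : ℝ) ≤ blockSize K T lam := by exact_mod_cast b2.le
    have h1 := leaderGap_nonneg i₀ (run T lam t h).1.updates (run T lam t h).2.1
    have h2 := (blockLoss_bounds T lam t h i₀).1
    have h3 := Real.sqrt_le_sqrt hu
    refine add_nonneg (add_nonneg (add_nonneg (by positivity) (mul_nonneg (by positivity)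
      (by linarith))) (by linarith)) (mul_nonneg hlam (by linarith))

/-- The update at the end of a block in which the losses of the arms sum up to `A`. -/
theorem block_end_step {K : ℕ} [NeZero K] {B : ℕ} (hB : 0 < B) (i₀ : Fin K) (n : ℕ)
    (L A p : Fin K → ℝ) (hp : p = tsallisWeights L (2 / √((n : ℝ) + 1)))
    (hA0 : ∀ i, 0 ≤ A i) (hA1 : ∀ i, A i ≤ B) :
    ∑ j, p j * (B * leaderGap i₀ (n + 1) (L + Pi.single j (A j / B / p j)) + A j)
      ≤ B * leaderGap i₀ n L + A i₀
        + 18 * √(K : ℝ) * B * (√((n : ℝ) + 1) - √(n : ℝ)) := by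
  have hB' : (0 : ℝ) < B := by exact_mod_cast hB
  have hstep := tsallis_step i₀ n L (fun i => A i / B) (fun i => by have := hA0 i; positivity)
    (fun i => by rw [div_le_one hB']; exact hA1 i) p hp
  have h1 := mul_le_mul_of_nonneg_left hstep hB'.le
  have h2 := sum_sqrt_ne_le (hp ▸ tsallisWeights_mem L _ : p ∈ stdSimplex ℝ (Fin K)) i₀
  have h3 := one_div_sqrt_succ_le n
  have h4 : 9 / √((n : ℝ) + 1) * ∑ i with i ≠ i₀, √(p i)
      ≤ 18 * (√((n : ℝ) + 1) - √(n : ℝ)) * √(K : ℝ) := by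
    have e : 9 / √((n : ℝ) + 1) = 9 * (1 / √((n : ℝ) + 1)) := by ring
    have h5 : 9 / √((n : ℝ) + 1) ≤ 18 * (√((n : ℝ) + 1) - √(n : ℝ)) := by rw [e]; linarith
    have h6 : 0 ≤ 9 / √((n : ℝ) + 1) := by positivity
    exact mul_le_mul h5 h2 (Finset.sum_nonneg fun i _ => Real.sqrt_nonneg _) (h6.trans h5)
  have e1 : (B : ℝ) * ∑ j, p j * (leaderGap i₀ (n + 1) (L + Pi.single j (A j / B / p j)) + A j / B)
      = ∑ j, p j * (B * leaderGap i₀ (n + 1) (L + Pi.single j (A j / B / p j)) + A j) := by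
    rw [Finset.mul_sum]
    refine Finset.sum_congr rfl fun j _ => ?_
    field_simp
  have e2 : (B : ℝ) * (A i₀ / B) = A i₀ := by field_simp
  rw [e1] at h1
  nlinarith

/-- The regret and the switches of the second phase are paid for by `entryCost`. -/
theorem integral_secondPhase_le {K : ℕ} [NeZero K] {T : ℕ} {lam : ℝ} (hlam : 0 ≤ lam)
    {env : Environment K} (hr : env.ReactsOnlyToFinishedBlocks T lam)
    (hB : 0 < blockSize K T lam) (i₀ : Fin K) :
    ∫ h, cum (inPhase T lam true (playedLoss K + lam • switchCost T lam)) T h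
        ∂(gameLaw T lam env T)
      ≤ ∫ h, cum (inPhase T lam true (armLoss i₀) + entryCost K T lam • enterCost T lam) T h
        ∂(gameLaw T lam env T) := by
  have hB' : (0 : ℝ) < blockSize K T lam := by exact_mod_cast hB
  have hM : 0 ≤ entryCost K T lam := by unfold entryCost; positivity
  refine integral_cum_le_of_potential hr
    (((isBounded_playedLoss K).add ((isBounded_switchCost T lam).smul lam)).inPhase T lam true)
    (((isBounded_armLoss i₀).inPhase T lam true).add ((isBounded_enterCost T lam).smul _))
    (inPhase_nonneg fun t h x => add_nonneg (playedLoss_nonneg h x)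
      (mul_nonneg hlam (switchCost_nonneg T lam h x)))
    (fun t h x => add_nonneg (inPhase_nonneg (fun t h x => armLoss_nonneg i₀ h x) _ _ _)
      (mul_nonneg hM (inPhase_nonneg (fun t h x => by split_ifs <;> simp) _ _ _)))
    (blockPotential T lam i₀) (measurable_blockPotential T lam i₀) (fun h => ?_)
    (fun t ht h => blockPotential_nonneg hlam hB i₀ ht h) (fun t _ h l => ?_)
  · simp [blockPotential, run, initState]
  obtain ⟨b1, b2, -⟩ := run_bounds hB t h
  cases hb : (run T lam t h).1.inBlocks with
  | false =>
    obtain ⟨hp, hu⟩ := b1 hb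
    rw [armMean_of_pos_eq_zero hp, armMean_of_pos_eq_zero hp]
    refine Finset.sum_le_sum fun i _ => mul_le_mul_of_nonneg_left ?_ ((stateWeights_mem _).1 i)
    by_cases hth : switchThreshold K T lam ≤ ((run T lam t h).1.switches
        + if (run T lam t h).1.last = some i then 0 else 1 : ℕ)
    · have hn := nextState_enter T lam (run T lam t h) i (l i) hb hth
      have hrun : run T lam (t + 1) (Fin.snoc h (i, l)) = _ := (run_snoc T lam t h (i, l)).trans hn
      have hbl : blockLoss T lam (t + 1) (Fin.snoc h (i, l)) = 0 :=
        blockLoss_of_pos_eq_zero (by rw [hrun])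
      simp only [inPhase, enterCost, blockPotential, hb, hrun, hbl, hth, Pi.add_apply,
        Pi.smul_apply, smul_eq_mul, if_true, leaderGap_zero]
      simp [entryCost]
    · have hn := nextState_stay T lam (run T lam t h) i (l i) hb hth
      have hrun : run T lam (t + 1) (Fin.snoc h (i, l)) = _ := (run_snoc T lam t h (i, l)).trans hn
      simp only [inPhase, enterCost, blockPotential, hb, hrun, hth, Pi.add_apply, Pi.smul_apply]
      simp
  | true =>
    have hin : ∀ j, (run T lam t (swapArm T lam j t h)).1.inBlocks = true := fun j =>
      (swapArm_spec T lam j t h).1.trans hb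
    rcases lt_or_ge ((run T lam t h).1.pos + 1) (blockSize K T lam) with h2 | h2
    · -- The block goes on: the pending regret moves exactly with the costs.
      have hstep : ∀ (g : History K t) (i : Fin K), (run T lam t g).1.inBlocks = true →
          (run T lam t g).1.pos + 1 < blockSize K T lam →
          ((run T lam t g).1.pos = 0 ∨ (run T lam t g).1.last = some i) →
          inPhase T lam true (playedLoss K + lam • switchCost T lam) t g (i, l)
            + blockPotential T lam i₀ (t + 1) (Fin.snoc g (i, l))
          ≤ (inPhase T lam true (armLoss i₀) + entryCost K T lam • enterCost T lam
              : Cost K) t g (i, l)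
            + blockPotential T lam i₀ t g := by
        intro g i hgb hg hgi
        have hn := nextState_inside T lam (run T lam t g) i (l i) hgb hg
        have hrun : run T lam (t + 1) (Fin.snoc g (i, l)) = _ :=
          (run_snoc T lam t g (i, l)).trans hn
        have hbl : blockLoss T lam (t + 1) (Fin.snoc g (i, l)) i₀
            = blockLoss T lam t g i₀ + l i₀ := by
          rw [blockLoss, if_neg (by rw [hrun]; simp), Fin.init_snoc, Fin.snoc_last]
        have hsw : lam * switchCost T lam t g (i, l)
            ≤ lam * (1 - if (run T lam t g).1.pos = 0 then 0 else 1) := by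
          refine mul_le_mul_of_nonneg_left ?_ hlam
          rcases hgi with hgi | hgi
          · simpa [hgi] using switchCost_le_one T lam g (i, l)
          · have : switchCost T lam t g (i, l) = 0 := by simp [switchCost, hgi]
            rw [this]
            split_ifs <;> simp
        simp only [inPhase, enterCost, blockPotential, hgb, hrun, hbl, Pi.add_apply, armLoss,
          playedLoss, Pi.smul_apply, smul_eq_mul, if_true, Nat.succ_ne_zero, if_false,
          Bool.true_eq_false]
        linarith
      rcases Nat.eq_zero_or_pos (run T lam t h).1.pos with hz | hz
      · rw [armMean_of_pos_eq_zero hz, armMean_of_pos_eq_zero hz]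
        exact Finset.sum_le_sum fun i _ => mul_le_mul_of_nonneg_left (hstep h i hb h2 (.inl hz))
          ((stateWeights_mem _).1 i)
      · rw [armMean_of_pos hz, armMean_of_pos hz]
        refine Finset.sum_le_sum fun j _ => mul_le_mul_of_nonneg_left (hstep _ j (hin j) ?_
          (.inr ?_)) ((stateWeights_mem _).1 j)
        · rwa [(swapArm_spec T lam j t h).2.2.1]
        · exact ((swapArm_spec T lam j t h).2.2.2.2.2.1 hz).1
    · -- The block ends: the pending regret is settled with the potential of Tsallis-INF.
      set u := (run T lam t h).1.updates with hu
      set L := (run T lam t h).2.1 with hL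
      set A : Fin K → ℝ := fun i => blockLoss T lam t h i + l i with hA
      set p := stateWeights (run T lam t h) with hp
      have hpu : ((run T lam t h).1.pos : ℝ) + 1 ≤ blockSize K T lam := by exact_mod_cast b2
      have hend := block_end_step hB i₀ u L A p rfl
        (fun i => add_nonneg (blockLoss_bounds T lam t h i).1 (l i).2.1)
        (fun i => by linarith [(blockLoss_bounds T lam t h i).2, (l i).2.2])
      set R := lam * ((T : ℝ) / blockSize K T lam + 1 - u - 1) with hR
      set W := 18 * √(K : ℝ) * blockSize K T lam with hW
      set τ := √((T : ℝ) / blockSize K T lam) with hτ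
      -- `g` is the history in which the arm `j` was played in the block. Everything that does not
      -- depend on the update is the same on both sides, up to `√(u + 1)` and `√u`.
      have hstep : ∀ (g : History K t) (j : Fin K), (run T lam t g).1.inBlocks = true →
          (run T lam t g).1.updates = u → (run T lam t g).1.pos = (run T lam t h).1.pos →
          (run T lam t g).2.1 = L → blockLoss T lam t g = blockLoss T lam t h →
          stateWeights (run T lam t g) = p →
          ((run T lam t g).1.pos = 0 ∨ (run T lam t g).1.last = some j) →
          (run T lam t g).2.2 = blockLoss T lam t h j →
          inPhase T lam true (playedLoss K + lam • switchCost T lam) t g (j, l)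
              + blockPotential T lam i₀ (t + 1) (Fin.snoc g (j, l))
            ≤ (blockSize K T lam
                * leaderGap i₀ (u + 1) (L + Pi.single j (A j / blockSize K T lam / p j)) + A j)
              + (lam * (1 - if (run T lam t h).1.pos = 0 then 0 else 1)
                - blockLoss T lam t h j
                + W * (τ - √((u : ℝ) + 1)) + blockSize K T lam + R) ∧
          (inPhase T lam true (armLoss i₀) + entryCost K T lam • enterCost T lam
              : Cost K) t g (j, l)
              + blockPotential T lam i₀ t g
            = (blockSize K T lam * leaderGap i₀ u L + A i₀)
              + (lam * (1 - if (run T lam t h).1.pos = 0 then 0 else 1)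
                - blockLoss T lam t h j
                + W * (τ - √(u : ℝ)) + blockSize K T lam + R) := by
        intro g j g1 g2 g3 g4 g5 g6 g7 g8
        have hn := nextState_block_end T lam (run T lam t g) j (l j) g1 (by rw [g3]; exact h2)
        have hrun : run T lam (t + 1) (Fin.snoc g (j, l)) = _ :=
          (run_snoc T lam t g (j, l)).trans hn
        have hbl : blockLoss T lam (t + 1) (Fin.snoc g (j, l)) = 0 :=
          blockLoss_of_pos_eq_zero (by rw [hrun])
        constructor
        · have hsw : lam * switchCost T lam t g (j, l)
              ≤ lam * (1 - if (run T lam t h).1.pos = 0 then 0 else 1) := by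
            refine mul_le_mul_of_nonneg_left ?_ hlam
            rw [← g3]
            rcases g7 with g7 | g7
            · simpa [g7] using switchCost_le_one T lam g (j, l)
            · have : switchCost T lam t g (j, l) = 0 := by simp [switchCost, g7]
              rw [this]
              split_ifs <;> simp
          simp only [inPhase, blockPotential, g1, hrun, hbl, Pi.add_apply, playedLoss, g2, g4, g6,
            g8, estimate, Pi.smul_apply, smul_eq_mul, if_true, Nat.cast_succ, Pi.zero_apply, hA,
            hR, ← hW, ← hτ]
          linarith
        · simp only [inPhase, enterCost, blockPotential, g1, g2, g3, g4, g5, g8, Pi.add_apply,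
            armLoss, Pi.smul_apply, smul_eq_mul, if_true, if_false, Bool.true_eq_false, hA, hR,
            ← hW, ← hτ]
          ring
      have hpm : p ∈ stdSimplex ℝ (Fin K) := stateWeights_mem _
      have hfin : ∀ X Y : Fin K → ℝ,
          (∀ j, X j ≤ (blockSize K T lam
                * leaderGap i₀ (u + 1) (L + Pi.single j (A j / blockSize K T lam / p j)) + A j)
              + (lam * (1 - if (run T lam t h).1.pos = 0 then 0 else 1)
                - blockLoss T lam t h j
                + W * (τ - √((u : ℝ) + 1)) + blockSize K T lam + R) ∧
            Y j = (blockSize K T lam * leaderGap i₀ u L + A i₀)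
              + (lam * (1 - if (run T lam t h).1.pos = 0 then 0 else 1)
                - blockLoss T lam t h j
                + W * (τ - √(u : ℝ)) + blockSize K T lam + R)) →
          ∑ j, p j * X j ≤ ∑ j, p j * Y j := by
        intro X Y hXY
        have e : ∀ j, p j * Y j = p j * (blockSize K T lam * leaderGap i₀ u L + A i₀
            + W * (√((u : ℝ) + 1) - √(u : ℝ)))
            + p j * (lam * (1 - if (run T lam t h).1.pos = 0 then 0 else 1)
                - blockLoss T lam t h j
                + W * (τ - √((u : ℝ) + 1)) + blockSize K T lam + R) := fun j => by
          rw [(hXY j).2]; ring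
        simp only [e, Finset.sum_add_distrib]
        rw [← Finset.sum_mul, hpm.2, one_mul]
        refine (Finset.sum_le_sum fun j _ =>
          mul_le_mul_of_nonneg_left (hXY j).1 (hpm.1 j)).trans ?_
        simp only [mul_add (p _) (_ + A _), Finset.sum_add_distrib]
        exact add_le_add_left hend _
      rcases Nat.eq_zero_or_pos (run T lam t h).1.pos with hz | hz
      · rw [armMean_of_pos_eq_zero hz, armMean_of_pos_eq_zero hz]
        refine hfin _ _ fun j => hstep h j hb rfl rfl rfl rfl rfl (.inl hz) ?_
        obtain ⟨-, -, -, b4, b5⟩ := run_bounds hB t h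
        rw [hz, Nat.cast_zero] at b5
        rw [blockLoss_of_pos_eq_zero hz]
        exact le_antisymm b5 b4
      · rw [armMean_of_pos hz, armMean_of_pos hz]
        refine hfin _ _ fun j => ?_
        obtain ⟨-, i2, i3, i4, i5, i6, -⟩ := swapArm_spec T lam j t h
        exact hstep _ j (hin j) i2 i3 i4 i5 (stateWeights_swapArm T lam j t h) (.inr (i6 hz).1)
          (i6 hz).2

/-! ### Counting switches -/

theorem nextState_last {K : ℕ} [NeZero K] (T : ℕ) (lam : ℝ) (s : State K) (i : Fin K) (x : ℝ) :
    (nextState T lam s i x).1.last = some i := by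
  unfold nextState
  dsimp only
  split_ifs <;> rfl

theorem cum_switchCost {K : ℕ} [NeZero K] (T : ℕ) (lam : ℝ) (t : ℕ) (h : History K t) :
    cum (switchCost T lam) t h = numSwitches h := by
  induction t with
  | zero => simp [cum, numSwitches]
  | succ t ih =>
    rw [cum, ih, numSwitches, numSwitches, Fin.sum_univ_castSucc, Nat.cast_add]
    congr 1
    have : prevArm h (Fin.last t) = (run T lam t (Fin.init h)).1.last := by
      cases t with
      | zero => simp [prevArm, run, initState]
      | succ t =>
        rw [run_succ, nextState_last, prevArm, if_pos (by simp)]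
        rfl
    rw [this, switchCost]
    split_ifs <;> simp

/-- The second phase is entered once the switches of the first phase reach the threshold, which they
exceed by at most one. -/
theorem cum_switchCost_firstPhase {K : ℕ} [NeZero K] {T : ℕ} {lam : ℝ}
    (hthr : 0 < switchThreshold K T lam) (t : ℕ) (h : History K t) :
    ((run T lam t h).1.inBlocks = false →
      cum (inPhase T lam false (switchCost T lam)) t h = (run T lam t h).1.switches ∧
      ((run T lam t h).1.switches : ℝ) < switchThreshold K T lam ∧
      cum (enterCost T lam) t h = 0) ∧
    ((run T lam t h).1.inBlocks = true →
      switchThreshold K T lam ≤ cum (inPhase T lam false (switchCost T lam)) t h ∧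
      cum (inPhase T lam false (switchCost T lam)) t h ≤ switchThreshold K T lam + 1 ∧
      cum (enterCost T lam) t h = 1) := by
  induction t with
  | zero => simp [cum, run, initState, hthr]
  | succ t ih =>
    obtain ⟨ih1, ih2⟩ := ih (Fin.init h)
    set s := run T lam t (Fin.init h) with hs
    simp only [cum]
    rw [run_succ, ← hs]
    set i := (h (Fin.last t)).1 with hi
    cases hb : s.1.inBlocks with
    | true =>
      have hb2 := nextState_inBlocks_of_inBlocks T lam s i ((h (Fin.last t)).2 i) hb
      obtain ⟨a1, a2, a3⟩ := ih2 hb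
      have e : enterCost T lam t (Fin.init h) (h (Fin.last t)) = 0 := by
        simp [inPhase, enterCost, ← hs, hb]
      rw [hb2, e, add_zero]
      simp [inPhase, ← hs, hb, a1, a2, a3]
    | false =>
      obtain ⟨a1, a2, a3⟩ := ih1 hb
      have e : cum (inPhase T lam false (switchCost T lam)) t (Fin.init h)
          + inPhase T lam false (switchCost T lam) t (Fin.init h) (h (Fin.last t))
          = ((s.1.switches + if s.1.last = some i then 0 else 1 : ℕ) : ℝ) := by
        rw [a1, inPhase, ← hs, if_pos hb, switchCost, ← hs, ← hi]
        split_ifs <;> simp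
      rw [e, a3]
      by_cases hth : switchThreshold K T lam
          ≤ (s.1.switches + if s.1.last = some i then 0 else 1 : ℕ)
      · rw [nextState_enter _ _ _ _ _ hb hth]
        refine ⟨by simp, fun _ => ⟨hth, ?_, ?_⟩⟩
        · push_cast
          split_ifs <;> linarith
        · rw [enterCost, inPhase, ← hs, if_pos hb, ← hi, if_pos hth, zero_add]
      · rw [nextState_stay _ _ _ _ _ hb hth]
        refine ⟨fun _ => ⟨rfl, not_le.1 hth, ?_⟩, by simp⟩
        rw [enterCost, inPhase, ← hs, if_pos hb, ← hi, if_neg hth, zero_add]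

/-- The indicator of the rounds in which an arm other than `i` is played. -/
noncomputable def missCost {K : ℕ} (i : Fin K) : Cost K := fun _ _ x => if x.1 = i then 0 else 1

/-- Of two different consecutive arms, at least one is not `i`. -/
theorem cum_switchCost_firstPhase_le_miss {K : ℕ} [NeZero K] (T : ℕ) (lam : ℝ) (i₀ : Fin K) (t : ℕ)
    (h : History K t) :
    cum (inPhase T lam false (switchCost T lam)) t h
        ≤ 1 + 2 * cum (inPhase T lam false (missCost i₀)) t h ∧
      ((run T lam t h).1.inBlocks = false → (run T lam t h).1.last ≠ some i₀ →
        cum (inPhase T lam false (switchCost T lam)) t h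
          ≤ 2 * cum (inPhase T lam false (missCost i₀)) t h) := by
  induction t with
  | zero => simp [cum]
  | succ t ih =>
    obtain ⟨ih1, ih2⟩ := ih (Fin.init h)
    set s := run T lam t (Fin.init h) with hs
    simp only [cum]
    rw [run_succ, ← hs, nextState_last]
    set i := (h (Fin.last t)).1 with hi
    cases hb : s.1.inBlocks with
    | true =>
      have hb2 := nextState_inBlocks_of_inBlocks T lam s i ((h (Fin.last t)).2 i) hb
      rw [hb2]
      simpa [inPhase, ← hs, hb] using ih1
    | false =>
      simp only [inPhase, ← hs, hb, if_true, missCost, ← hi]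
      have hsw1 := switchCost_le_one T lam (Fin.init h) (h (Fin.last t))
      by_cases hii : i = i₀
      · simp only [hii, if_true, add_zero, ne_eq, not_true_eq_false, false_implies, implies_true,
          and_true]
        by_cases hl : s.1.last = some i₀
        · have : switchCost T lam t (Fin.init h) (h (Fin.last t)) = 0 := by
            simp [switchCost, ← hs, ← hi, hii, hl]
          rw [this]
          simpa using ih1
        · have := ih2 hb hl
          linarith
      · simp only [hii, if_false]
        refine ⟨?_, fun _ _ => ?_⟩ <;> linarith

/-! ### The regret and its decomposition -/

/-- The expected regret, switching costs included, against the fixed arm `i₀`. -/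
noncomputable def regretAgainst {K : ℕ} [NeZero K] (T : ℕ) (lam : ℝ) (env : Environment K)
    (i₀ : Fin K) : ℝ :=
  ∫ h, cum (playedLoss K) T h ∂(gameLaw T lam env T)
    - ∫ h, cum (armLoss i₀) T h ∂(gameLaw T lam env T)
    + lam * ∫ h, cum (switchCost T lam) T h ∂(gameLaw T lam env T)

theorem integral_cum_armLoss {K : ℕ} [NeZero K] (T : ℕ) (lam : ℝ) (env : Environment K)
    (i : Fin K) :
    ∫ h, cum (armLoss i) T h ∂(gameLaw T lam env T)
      = ∑ t, ∫ g, ((g t).2 i : ℝ) ∂(gameLaw T lam env T) := by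
  rw [← integral_finsetSum]
  · refine integral_congr_ae (Filter.Eventually.of_forall fun h => ?_)
    exact cum_eq_sum (fun _ x => (x.2 i : ℝ)) T h
  · intro t _
    refine Integrable.of_bound (C := 1) ?_ (Filter.Eventually.of_forall fun h => ?_)
    · exact (measurable_subtype_coe.comp ((measurable_pi_apply i).comp
        (measurable_snd.comp (measurable_pi_apply t)))).aestronglyMeasurable
    · rw [Real.norm_of_nonneg ((h t).2 i).2.1]; exact ((h t).2 i).2.2

theorem exists_expectedRegret_eq {K : ℕ} [NeZero K] (T : ℕ) (lam : ℝ) (env : Environment K) :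
    ∃ i₀, expectedRegret T lam env = regretAgainst T lam env i₀ := by
  set m : Fin K → ℝ := fun i => ∑ t, ∫ g, ((g t).2 i : ℝ) ∂(gameLaw T lam env T) with hm
  have hE : expectedRegret T lam env
      = ∫ h, cum (playedLoss K) T h ∂(gameLaw T lam env T) - (⨅ i, m i)
        + lam * ∫ h, cum (switchCost T lam) T h ∂(gameLaw T lam env T) := by
    have e : ∀ h, pseudoRegret lam (gameLaw T lam env T) h
        = cum (playedLoss K) T h - (⨅ i, m i) + lam * cum (switchCost T lam) T h := fun h => by
      rw [pseudoRegret, cum_switchCost]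
      congr 2
      exact (cum_eq_sum (fun _ x => (x.2 x.1 : ℝ)) T h).symm
    have i1 := integrable_cum (isBounded_playedLoss K) T (gameLaw T lam env T)
    have i2 := integrable_cum (isBounded_switchCost (K := K) T lam) T (gameLaw T lam env T)
    simp only [expectedRegret, e]
    have i3 : Integrable (fun h => cum (playedLoss K) T h - ⨅ i, m i) (gameLaw T lam env T) :=
      i1.sub (integrable_const _)
    rw [integral_add i3 (i2.const_mul _), integral_sub i1 (integrable_const _),
      integral_const_mul]
    simp
  obtain ⟨i₀, hi₀⟩ := exists_eq_ciInf_of_finite (f := m)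
  exact ⟨i₀, by rw [hE, regretAgainst, integral_cum_armLoss, ← hi₀]⟩

theorem integral_cum_add {K : ℕ} {f g : Cost K} (hf : f.IsBounded) (hg : g.IsBounded) (t : ℕ)
    (μ : Measure (History K t)) [IsFiniteMeasure μ] :
    ∫ h, cum (f + g) t h ∂μ = ∫ h, cum f t h ∂μ + ∫ h, cum g t h ∂μ := by
  simp only [cum_add]
  exact integral_add (integrable_cum hf t μ) (integrable_cum hg t μ)

theorem integral_cum_smul {K : ℕ} (c : ℝ) (f : Cost K) (t : ℕ) (μ : Measure (History K t)) :
    ∫ h, cum (c • f) t h ∂μ = c * ∫ h, cum f t h ∂μ := by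
  simp only [cum_smul]
  exact integral_const_mul _ _

theorem inPhase_add {K : ℕ} [NeZero K] (T : ℕ) (lam : ℝ) (b : Bool) (f g : Cost K) :
    inPhase T lam b (f + g) = inPhase T lam b f + inPhase T lam b g := by
  funext t h x
  simp only [inPhase, Pi.add_apply]
  split_ifs <;> simp

theorem inPhase_smul {K : ℕ} [NeZero K] (T : ℕ) (lam : ℝ) (b : Bool) (c : ℝ) (f : Cost K) :
    inPhase T lam b (c • f) = c • inPhase T lam b f := by
  funext t h x
  simp only [inPhase, Pi.smul_apply]
  split_ifs <;> simp

/-- The regret is at most the regret of the first phase, the cost of its switches, and the cost of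
the second phase, paid upon entering it. -/
theorem regretAgainst_le {K : ℕ} [NeZero K] {T : ℕ} {lam : ℝ} (hlam : 0 ≤ lam)
    {env : Environment K} (hr : env.ReactsOnlyToFinishedBlocks T lam)
    (hB : 0 < blockSize K T lam) (i₀ : Fin K) :
    regretAgainst T lam env i₀
      ≤ (∫ h, cum (inPhase T lam false (playedLoss K)) T h ∂(gameLaw T lam env T)
          - ∫ h, cum (inPhase T lam false (armLoss i₀)) T h ∂(gameLaw T lam env T))
        + lam * ∫ h, cum (inPhase T lam false (switchCost T lam)) T h ∂(gameLaw T lam env T)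
        + entryCost K T lam * ∫ h, cum (enterCost T lam) T h ∂(gameLaw T lam env T) := by
  have hsplit : ∀ {f : Cost K}, f.IsBounded → ∫ h, cum f T h ∂(gameLaw T lam env T)
      = ∫ h, cum (inPhase T lam false f) T h ∂(gameLaw T lam env T)
        + ∫ h, cum (inPhase T lam true f) T h ∂(gameLaw T lam env T) := fun {f} hf => by
    rw [← integral_cum_add (hf.inPhase T lam _) (hf.inPhase T lam _), inPhase_add_inPhase]
  have h2 := integral_secondPhase_le hlam hr hB i₀
  rw [inPhase_add, inPhase_smul, integral_cum_add ((isBounded_playedLoss K).inPhase T lam _)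
    (((isBounded_switchCost T lam).inPhase T lam _).smul _), integral_cum_smul,
    integral_cum_add ((isBounded_armLoss i₀).inPhase T lam _)
    ((isBounded_enterCost T lam).smul _), integral_cum_smul] at h2
  rw [regretAgainst, hsplit (isBounded_playedLoss K), hsplit (isBounded_armLoss i₀),
    hsplit (isBounded_switchCost T lam)]
  linarith

theorem cum_exploration_le {K : ℕ} [NeZero K] (T : ℕ) (lam : ℝ) (i₀ : Fin K) (t : ℕ)
    (h : History K t) :
    cum (inPhase T lam false (exploration T lam i₀)) t h ≤ 18 * √(K : ℝ) * √(t : ℝ) := by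
  induction t with
  | zero => simp [cum]
  | succ t ih =>
    rw [cum]
    have h1 := ih (Fin.init h)
    have h2 : inPhase T lam false (exploration T lam i₀) t (Fin.init h) (h (Fin.last t))
        ≤ exploration T lam i₀ t (Fin.init h) (h (Fin.last t)) := by
      unfold inPhase
      split_ifs
      · exact le_rfl
      · exact exploration_nonneg _ _ _ _ _
    have h3 := sum_sqrt_ne_le (stateWeights_mem (run T lam t (Fin.init h))) i₀
    have h4 : exploration T lam i₀ t (Fin.init h) (h (Fin.last t))
        ≤ 9 * (1 / √((t : ℝ) + 1)) * √(K : ℝ) := by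
      rw [mul_one_div]
      exact mul_le_mul_of_nonneg_left h3 (by positivity)
    have h5 := mul_le_mul_of_nonneg_left (one_div_sqrt_succ_le t) (Real.sqrt_nonneg (K : ℝ))
    push_cast
    linarith

/-- The worst-case bound, against any fixed arm and for every environment that does not react to the
arm of an unfinished block. -/
theorem regretAgainst_le_adversarial {K : ℕ} [NeZero K] {T : ℕ} {lam : ℝ} (hlam : 0 ≤ lam)
    {env : Environment K} (hr : env.ReactsOnlyToFinishedBlocks T lam)
    (hB : 0 < blockSize K T lam) (hthr : 0 < switchThreshold K T lam) (i₀ : Fin K) :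
    regretAgainst T lam env i₀
      ≤ 18 * √(K : ℝ) * √(T : ℝ) + lam * (switchThreshold K T lam + 1) + entryCost K T lam := by
  have h1 := regretAgainst_le hlam hr hB i₀
  have h2 := integral_playedLoss_firstPhase_le hr hB i₀
  rw [inPhase_add, integral_cum_add ((isBounded_armLoss i₀).inPhase T lam _)
    ((isBounded_exploration T lam i₀).inPhase T lam _)] at h2
  have hc : ∀ {f : Cost K} {C : ℝ}, f.IsBounded → (∀ h, cum f T h ≤ C) →
      ∫ h, cum f T h ∂(gameLaw T lam env T) ≤ C := fun {f C} hf hC => by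
    have := integral_mono (integrable_cum hf T (gameLaw T lam env T)) (integrable_const C) hC
    simpa using this
  have h3 := hc ((isBounded_exploration T lam i₀).inPhase T lam false)
    (cum_exploration_le T lam i₀ T)
  have h4 := hc (C := switchThreshold K T lam + 1)
    ((isBounded_switchCost T lam).inPhase T lam false) fun h => by
      obtain ⟨a, b⟩ := cum_switchCost_firstPhase hthr T h
      cases hb : (run T lam T h).1.inBlocks with
      | true => exact (b hb).2.1
      | false => rw [(a hb).1]; linarith [(a hb).2.1]
  have h5 := hc (C := 1) (isBounded_enterCost (K := K) T lam) fun h => by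
      obtain ⟨a, b⟩ := cum_switchCost_firstPhase hthr T h
      cases hb : (run T lam T h).1.inBlocks with
      | true => rw [(b hb).2.2]
      | false => rw [(a hb).2.2]; exact zero_le_one
  have hM : 0 ≤ entryCost K T lam := by unfold entryCost; positivity
  have h6 := mul_le_mul_of_nonneg_left h4 hlam
  have h7 := mul_le_mul_of_nonneg_left h5 hM
  linarith

/-! ### Stochastically constrained environments -/

/-- The gap of the arm that is played. The gap of `istar` is zero, whatever `Δ istar` is. -/
noncomputable def gapCost {K : ℕ} (istar : Fin K) (Δ : Fin K → ℝ) : Cost K :=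
  fun _ _ x => if x.1 = istar then 0 else Δ x.1

/-- The mean gap of the arm drawn from the Tsallis-INF distribution. -/
noncomputable def meanGapCost {K : ℕ} [NeZero K] (T : ℕ) (lam : ℝ) (istar : Fin K)
    (Δ : Fin K → ℝ) : Cost K :=
  fun t h _ => ∑ i, stateWeights (run T lam t h) i * if i = istar then 0 else Δ i

theorem exists_abs_gap_le {K : ℕ} (istar : Fin K) (Δ : Fin K → ℝ) (i : Fin K) :
    |if i = istar then 0 else Δ i| ≤ ∑ j, |Δ j| := by
  have h0 := Finset.single_le_sum (f := fun j => |Δ j|) (fun j _ => abs_nonneg _)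
    (Finset.mem_univ i)
  split_ifs
  · rw [abs_zero]; exact (abs_nonneg _).trans h0
  · exact h0

theorem isBounded_gapCost {K : ℕ} [NeZero K] (istar : Fin K) (Δ : Fin K → ℝ) :
    (gapCost istar Δ).IsBounded :=
  isBounded_of_control 0 0 (fun _ i => if i = istar then 0 else Δ i) fun _ i =>
    exists_abs_gap_le istar Δ i

theorem isBounded_missCost {K : ℕ} [NeZero K] (i₀ : Fin K) : (missCost i₀).IsBounded :=
  isBounded_of_control 0 0 (fun _ i => if i = i₀ then 0 else 1) (C := 1) fun _ i => by
    split_ifs <;> simp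

theorem isBounded_meanGapCost {K : ℕ} [NeZero K] (T : ℕ) (lam : ℝ) (istar : Fin K)
    (Δ : Fin K → ℝ) : (meanGapCost T lam istar Δ).IsBounded := by
  refine ⟨fun t => ?_, ∑ j, |Δ j|, fun t h x => ?_⟩
  · exact Finset.measurable_sum _ fun i _ =>
      ((measurable_stateWeights_run T lam t i).comp measurable_fst).mul_const _
  · have hm := stateWeights_mem (run T lam t h)
    refine (Finset.abs_sum_le_sum_abs _ _).trans ?_
    calc _ ≤ ∑ i, stateWeights (run T lam t h) i * ∑ j, |Δ j| := by
          refine Finset.sum_le_sum fun i _ => ?_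
          rw [abs_mul, abs_of_nonneg (hm.1 i)]
          exact mul_le_mul_of_nonneg_left (exists_abs_gap_le istar Δ i) (hm.1 i)
      _ = _ := by rw [← Finset.sum_mul, hm.2, one_mul]

/-- In every round, the conditional mean of the regret is the gap of the arm that is played. -/
theorem firstPhase_regret_eq {K : ℕ} [NeZero K] {T : ℕ} {lam : ℝ} {env : Environment K}
    {istar : Fin K} {Δ : Fin K → ℝ} (hs : env.IsStochasticallyConstrained istar Δ) :
    ∫ h, cum (inPhase T lam false (playedLoss K)) T h ∂(gameLaw T lam env T)
        - ∫ h, cum (inPhase T lam false (armLoss istar)) T h ∂(gameLaw T lam env T)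
      = ∫ h, cum (inPhase T lam false (gapCost istar Δ)) T h ∂(gameLaw T lam env T) := by
  have hb1 := (isBounded_playedLoss K).inPhase T lam false
  have hb2 := (isBounded_armLoss istar).inPhase T lam false
  have hb3 := (isBounded_gapCost istar Δ).inPhase T lam false
  have e : ∀ t h, ∑ i, armProb (run T lam t h) i * ∫ l, (inPhase T lam false (playedLoss K)
        + (-1 : ℝ) • inPhase T lam false (armLoss istar) : Cost K) t h (i, l) ∂(env.lossKernel t h)
      = ∑ i, armProb (run T lam t h) i * ∫ l, inPhase T lam false (gapCost istar Δ) t h (i, l)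
        ∂(env.lossKernel t h) := by
    intro t h
    refine Finset.sum_congr rfl fun i _ => ?_
    congr 1
    simp only [Pi.add_apply, Pi.smul_apply, inPhase, playedLoss, armLoss, gapCost, smul_eq_mul]
    split_ifs with hb hi
    · simp [hi]
    · rw [integral_const]
      simp only [probReal_univ, one_smul]
      rw [← hs t h i hi]
      refine integral_congr_ae (Filter.Eventually.of_forall fun l => ?_)
      simp only
      ring
    · simp
  have h1 := integral_cum_le_of_mean_le T lam env (hb1.add (hb2.smul (-1))) hb3
    (fun t h => (e t h).le) T
  have h2 := integral_cum_le_of_mean_le T lam env hb3 (hb1.add (hb2.smul (-1)))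
    (fun t h => (e t h).ge) T
  rw [integral_cum_add hb1 (hb2.smul _), integral_cum_smul] at h1 h2
  linarith

/-- In the first phase the arm is drawn from the Tsallis-INF distribution. -/
theorem integral_meanGapCost_le {K : ℕ} [NeZero K] {T : ℕ} {lam : ℝ} {env : Environment K}
    (hB : 0 < blockSize K T lam) (istar : Fin K) (Δ : Fin K → ℝ) :
    ∫ h, cum (inPhase T lam false (meanGapCost T lam istar Δ)) T h ∂(gameLaw T lam env T)
      ≤ ∫ h, cum (inPhase T lam false (gapCost istar Δ)) T h ∂(gameLaw T lam env T) := by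
  refine integral_cum_le_of_mean_le T lam env
    ((isBounded_meanGapCost T lam istar Δ).inPhase T lam false)
    ((isBounded_gapCost istar Δ).inPhase T lam false) (fun t h => ?_) T
  cases hb : (run T lam t h).1.inBlocks with
  | true => simp [inPhase, hb]
  | false =>
    have hp := ((run_bounds hB t h).1 hb).1
    simp only [inPhase, hb, if_true, meanGapCost, gapCost, integral_const,
      probReal_univ, one_smul, armProb_of_pos_eq_zero hp]
    rw [← Finset.sum_mul, (stateWeights_mem _).2, one_mul]

theorem cum_one_div_succ_le {K : ℕ} (t : ℕ) (h : History K t) :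
    cum (fun t _ _ => 1 / ((t : ℝ) + 1)) t h ≤ 1 + Real.log t := by
  rw [cum_eq_sum (fun t _ => 1 / ((t : ℝ) + 1)),
    Fin.sum_univ_eq_sum_range (fun r => 1 / ((r : ℝ) + 1))]
  refine le_trans (le_of_eq ?_) (harmonic_le_one_add_log t)
  simp [harmonic]

/-- The regret of the first phase bounds itself: it is at most half of itself plus
`81/2 * ∑ 1 / Δᵢ * (1 + log T)`. -/
theorem firstPhase_gap_le {K : ℕ} [NeZero K] {T : ℕ} {lam : ℝ} {env : Environment K}
    (hr : env.ReactsOnlyToFinishedBlocks T lam) (hB : 0 < blockSize K T lam)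
    {istar : Fin K} {Δ : Fin K → ℝ} (hΔ : ∀ i, i ≠ istar → 0 < Δ i)
    (hs : env.IsStochasticallyConstrained istar Δ) :
    ∫ h, cum (inPhase T lam false (gapCost istar Δ)) T h ∂(gameLaw T lam env T)
      ≤ 81 * (∑ i with i ≠ istar, 1 / Δ i) * (1 + Real.log T) := by
  have h1 := integral_playedLoss_firstPhase_le hr hB istar
  rw [inPhase_add, integral_cum_add ((isBounded_armLoss istar).inPhase T lam _)
    ((isBounded_exploration T lam istar).inPhase T lam _)] at h1
  have h2 := firstPhase_regret_eq (T := T) (lam := lam) hs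
  have h3 := integral_meanGapCost_le (T := T) (lam := lam) (env := env) hB istar Δ
  set D := ∑ i with i ≠ istar, 1 / Δ i with hD
  have hD0 : 0 ≤ D := Finset.sum_nonneg fun i hi =>
    one_div_nonneg.2 (hΔ i (Finset.mem_filter.1 hi).2).le
  set inv : Cost K := fun t _ _ => 1 / ((t : ℝ) + 1) with hinv
  have hinvb : inv.IsBounded := by
    refine ⟨fun t => measurable_const, 1, fun t h x => ?_⟩
    rw [abs_of_nonneg (by positivity)]
    exact div_le_one_of_le₀ (by simp) (by positivity)
  have hmg := (isBounded_meanGapCost T lam istar Δ).inPhase T lam false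
  have hpt : ∀ t h x, inPhase T lam false (exploration T lam istar) t h x
      ≤ ((1 / 2 : ℝ) • inPhase T lam false (meanGapCost T lam istar Δ)
        + (81 / 2 * D) • inv : Cost K) t h x := by
    intro t h x
    simp only [inPhase, Pi.add_apply, Pi.smul_apply, smul_eq_mul]
    have hi0 : 0 ≤ inv t h x := by positivity
    split_ifs with hb
    · have e : ∀ i ∈ Finset.univ.filter (· ≠ istar),
          9 / √((t : ℝ) + 1) * √(stateWeights (run T lam t h) i)
            ≤ 1 / 2 * (stateWeights (run T lam t h) i * Δ i)
              + 81 / 2 * (1 / Δ i) * (1 / ((t : ℝ) + 1)) := by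
        intro i hi
        have hΔi := hΔ i (Finset.mem_filter.1 hi).2
        set w := stateWeights (run T lam t h) i with hw
        have hw0 : 0 ≤ w := (stateWeights_mem _).1 i
        have hc : 0 < √((t : ℝ) + 1) := by positivity
        have hcs := Real.sq_sqrt (by positivity : 0 ≤ (t : ℝ) + 1)
        have hws := Real.sq_sqrt hw0
        set c := √((t : ℝ) + 1)
        set r := √w
        rw [← hcs, ← hws]
        -- The inequality of the arithmetic and geometric means, as a square.
        have : 1 / 2 * (r ^ 2 * Δ i) + 81 / 2 * (1 / Δ i) * (1 / c ^ 2) - 9 / c * r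
            = Δ i / 2 * (r - 9 / (c * Δ i)) ^ 2 := by
          field_simp
          ring
        have h4 : 0 ≤ Δ i / 2 * (r - 9 / (c * Δ i)) ^ 2 := by positivity
        linarith
      have hsum := Finset.sum_le_sum e
      rw [← Finset.mul_sum, Finset.sum_add_distrib, ← Finset.mul_sum, ← Finset.sum_mul,
        ← Finset.mul_sum, ← hD] at hsum
      have e2 : meanGapCost T lam istar Δ t h x
          = ∑ i with i ≠ istar, stateWeights (run T lam t h) i * Δ i := by
        rw [meanGapCost, Finset.sum_filter]
        refine Finset.sum_congr rfl fun i _ => ?_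
        by_cases hi : i = istar <;> simp [hi]
      rw [e2]
      exact hsum
    · positivity
  have h4 := integral_mono (integrable_cum ((isBounded_exploration T lam istar).inPhase T lam false)
      T (gameLaw T lam env T))
    (integrable_cum ((hmg.smul (1 / 2)).add (hinvb.smul (81 / 2 * D))) T _)
    (cum_mono hpt T)
  rw [integral_cum_add (hmg.smul _) (hinvb.smul _), integral_cum_smul, integral_cum_smul] at h4
  have h5 : ∫ h, cum inv T h ∂(gameLaw T lam env T) ≤ 1 + Real.log T := by
    have := integral_mono (integrable_cum hinvb T (gameLaw T lam env T)) (integrable_const _)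
      (cum_one_div_succ_le T)
    simpa using this
  have h6 := mul_le_mul_of_nonneg_left h5 (by positivity : 0 ≤ 81 / 2 * D)
  linarith

/-- The bound in terms of the gaps, for a bound `R` on the regret of the first phase. The
probability of entering the second phase is at most the expected number of switches of the first
phase, divided by the threshold. -/
theorem regretAgainst_le_stochastic {K : ℕ} [NeZero K] {T : ℕ} {lam c δ : ℝ} (hlam : 0 ≤ lam)
    {env : Environment K} (hr : env.ReactsOnlyToFinishedBlocks T lam)
    (hB : 0 < blockSize K T lam) (hthr : 0 < switchThreshold K T lam)
    {istar : Fin K} {Δ : Fin K → ℝ} (hδ : 0 < δ) (hΔ : ∀ i, i ≠ istar → δ ≤ Δ i)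
    (hs : env.IsStochasticallyConstrained istar Δ) (hc : 0 ≤ c)
    (hentry : entryCost K T lam ≤ c * (lam * switchThreshold K T lam)) {R : ℝ}
    (hR : 81 * (∑ i with i ≠ istar, 1 / Δ i) * (1 + Real.log T) ≤ R) :
    regretAgainst T lam env istar ≤ R + (1 + c) * (lam * (1 + 2 * R / δ)) := by
  have h1 := regretAgainst_le hlam hr hB istar
  rw [firstPhase_regret_eq hs] at h1
  have h2 := (firstPhase_gap_le hr hB (fun i hi => hδ.trans_le (hΔ i hi)) hs).trans hR
  have hbs := (isBounded_switchCost (K := K) T lam).inPhase T lam false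
  have hbm := (isBounded_missCost istar).inPhase T lam false
  have hbg := (isBounded_gapCost istar Δ).inPhase T lam false
  have hmiss : ∫ h, cum (inPhase T lam false (missCost istar)) T h ∂(gameLaw T lam env T)
      ≤ R / δ := by
    have := integral_mono (integrable_cum hbm T (gameLaw T lam env T))
      (integrable_cum (hbg.smul (1 / δ)) T _) (cum_mono (fun t h x => by
        simp only [inPhase, missCost, gapCost, Pi.smul_apply, smul_eq_mul]
        split_ifs with _ hx
        · simp
        · rw [one_div_mul_eq_div, one_le_div hδ]; exact hΔ _ hx
        · simp) T)
    rw [integral_cum_smul] at this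
    refine this.trans ?_
    rw [one_div_mul_eq_div]
    gcongr
  set S := ∫ h, cum (inPhase T lam false (switchCost T lam)) T h ∂(gameLaw T lam env T) with hS
  have hS1 : S ≤ 1 + 2 * R / δ := by
    have := integral_mono (integrable_cum hbs T (gameLaw T lam env T))
      ((integrable_const 1).add ((integrable_cum hbm T _).const_mul 2))
      (fun h => (cum_switchCost_firstPhase_le_miss T lam istar T h).1)
    simp only [Pi.add_apply] at this
    rw [integral_add (integrable_const _) ((integrable_cum hbm T _).const_mul 2),
      integral_const_mul] at this
    simp only [integral_const, probReal_univ, one_smul] at this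
    rw [mul_div_assoc]
    linarith
  have hS2 : switchThreshold K T lam * ∫ h, cum (enterCost T lam) T h ∂(gameLaw T lam env T)
      ≤ S := by
    rw [← integral_const_mul]
    refine integral_mono ((integrable_cum (isBounded_enterCost T lam) T _).const_mul _)
      (integrable_cum hbs T _) fun h => ?_
    obtain ⟨a, b⟩ := cum_switchCost_firstPhase hthr T h
    simp only
    cases hb : (run T lam T h).1.inBlocks with
    | true => rw [(b hb).2.2, mul_one]; exact (b hb).1
    | false =>
      rw [(a hb).2.2, mul_zero, (a hb).1]
      positivity
  have hE0 : 0 ≤ ∫ h, cum (enterCost T lam) T h ∂(gameLaw T lam env T) :=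
    integral_nonneg fun h => cum_nonneg
      (inPhase_nonneg fun t h x => by split_ifs <;> simp) _ _
  have h3 := mul_le_mul_of_nonneg_right hentry hE0
  have h4 := mul_le_mul_of_nonneg_left hS2 (by positivity : 0 ≤ c * lam)
  have h5 := mul_le_mul_of_nonneg_left hS1 (by positivity : 0 ≤ (1 + c) * lam)
  linarith

/-! ### The parameters and the bounds for the algorithm -/

/-- The comparison of all parts of the bound with `(λK)^{1/3} T^{2/3}`. -/
theorem parameter_bounds {K T : ℕ} {lam : ℝ} (hK : 0 < K) (hT : 0 < T)
    (h1 : √((K : ℝ) / T) ≤ lam) (h2 : lam ≤ √(K : ℝ) * T) :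
    0 < lam ∧ 0 < switchThreshold K T lam ∧
    lam * switchThreshold K T lam = (lam * K) ^ (1 / 3 : ℝ) * (T : ℝ) ^ (2 / 3 : ℝ) ∧
    lam ≤ (lam * K) ^ (1 / 3 : ℝ) * (T : ℝ) ^ (2 / 3 : ℝ) ∧
    √(K : ℝ) * √(T : ℝ) ≤ (lam * K) ^ (1 / 3 : ℝ) * (T : ℝ) ^ (2 / 3 : ℝ) ∧
    entryCost K T lam ≤ 31 * ((lam * K) ^ (1 / 3 : ℝ) * (T : ℝ) ^ (2 / 3 : ℝ)) := by
  have hK' : (0 : ℝ) < K := by exact_mod_cast hK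
  have hT' : (0 : ℝ) < T := by exact_mod_cast hT
  have hlam : 0 < lam := (Real.sqrt_pos.2 (by positivity)).trans_le h1
  have cube : ∀ x : ℝ, 0 < x → (x ^ (1 / 3 : ℝ)) ^ 3 = x := fun x hx => by
    rw [← Real.rpow_natCast, ← Real.rpow_mul hx.le]; norm_num
  have square : ∀ x : ℝ, 0 < x → x ^ (2 / 3 : ℝ) = (x ^ (1 / 3 : ℝ)) ^ 2 := fun x hx => by
    rw [← Real.rpow_natCast, ← Real.rpow_mul hx.le]; norm_num
  have hU : (lam * K) ^ (1 / 3 : ℝ) * (T : ℝ) ^ (2 / 3 : ℝ)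
      = lam ^ (1 / 3 : ℝ) * (K : ℝ) ^ (1 / 3 : ℝ) * ((T : ℝ) ^ (1 / 3 : ℝ)) ^ 2 := by
    rw [Real.mul_rpow hlam.le hK'.le, square _ hT']
  have hthr : switchThreshold K T lam = (K : ℝ) ^ (1 / 3 : ℝ) * ((T : ℝ) ^ (1 / 3 : ℝ)) ^ 2
      / (lam ^ (1 / 3 : ℝ)) ^ 2 := by
    rw [switchThreshold, square _ (by positivity), Real.div_rpow hT'.le hlam.le, div_pow,
      mul_div_assoc]
  have hbs : blockSize K T lam = ⌈(lam ^ (1 / 3 : ℝ)) ^ 2 * ((K : ℝ) ^ (1 / 3 : ℝ))⁻¹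
      * (T : ℝ) ^ (1 / 3 : ℝ)⌉₊ := by
    rw [blockSize, square _ hlam, Real.rpow_neg hK'.le]
  have hk1 : 1 ≤ (K : ℝ) ^ (1 / 3 : ℝ) :=
    Real.one_le_rpow (by exact_mod_cast hK) (by norm_num)
  have ha0 : 0 < lam ^ (1 / 3 : ℝ) := by positivity
  have ht0 : 0 < (T : ℝ) ^ (1 / 3 : ℝ) := by positivity
  have ha3 := cube _ hlam
  have hk3 := cube _ hK'
  have ht3 := cube _ hT'
  rw [hU]
  unfold entryCost
  rw [hthr]
  set a := lam ^ (1 / 3 : ℝ)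
  set k := (K : ℝ) ^ (1 / 3 : ℝ)
  set τ := (T : ℝ) ^ (1 / 3 : ℝ)
  have hk0 : 0 < k := by linarith
  set β := a ^ 2 * k⁻¹ * τ with hβ
  have hβ0 : 0 < β := by positivity
  -- The two bounds on the switching cost, in terms of the cube roots of `λ`, `K` and `T`.
  have hlow : k ≤ a ^ 2 * τ := by
    have h3 : (K : ℝ) / T ≤ lam ^ 2 := (Real.sqrt_le_left hlam.le).1 h1
    rw [div_le_iff₀ hT', ← ha3, ← hk3, ← ht3] at h3
    refine le_of_pow_le_pow_left₀ (n := 3) (by norm_num) (by positivity) (h3.trans_eq ?_)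
    ring
  have hupp : a ^ 2 ≤ k * τ ^ 2 := by
    have h3 : lam ^ 2 ≤ (√(K : ℝ) * T) ^ 2 := by gcongr
    rw [mul_pow, Real.sq_sqrt hK'.le, ← ha3, ← hk3, ← ht3] at h3
    refine le_of_pow_le_pow_left₀ (n := 3) (by norm_num) (by positivity) (le_trans (le_of_eq ?_)
      (h3.trans_eq ?_)) <;> ring
  have hupp' : a ≤ k ^ 2 * τ := by
    refine le_of_pow_le_pow_left₀ (n := 2) (by norm_num) (by positivity) (hupp.trans ?_)
    have : k ≤ k ^ 4 := le_self_pow₀ hk1 (by norm_num)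
    calc k * τ ^ 2 ≤ k ^ 4 * τ ^ 2 := by gcongr
      _ = (k ^ 2 * τ) ^ 2 := by ring
  have hβ1 : 1 ≤ β := by
    have e : β = a ^ 2 * τ / k := by rw [hβ]; field_simp
    rw [e, one_le_div hk0]
    exact hlow
  have hB1 : β ≤ blockSize K T lam := by rw [hbs]; exact Nat.le_ceil _
  have hB2 : (blockSize K T lam : ℝ) ≤ 2 * β := by
    rw [hbs]
    have := Nat.ceil_lt_add_one hβ0.le
    linarith
  set B : ℝ := (blockSize K T lam : ℝ)
  have hB0 : 0 < B := by linarith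
  have hlamU : lam ≤ a * k * τ ^ 2 := by
    rw [← ha3]
    calc a ^ 3 = a * a ^ 2 := by ring
      _ ≤ a * (k * τ ^ 2) := by gcongr
      _ = _ := by ring
  refine ⟨hlam, by positivity, ?_, hlamU, ?_, ?_⟩
  · rw [← ha3]; field_simp
  · rw [← Real.sqrt_mul hK'.le]
    refine Real.sqrt_le_iff.2 ⟨by positivity, ?_⟩
    rw [← hk3, ← ht3]
    calc k ^ 3 * τ ^ 3 = k ^ 2 * τ ^ 3 * k := by ring
      _ ≤ k ^ 2 * τ ^ 3 * (a ^ 2 * τ) := by gcongr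
      _ = _ := by ring
  · have e1 : √(K : ℝ) * B * √((T : ℝ) / B) ≤ 3 / 2 * (a * k * τ ^ 2) := by
      refine le_of_pow_le_pow_left₀ (n := 2) (by norm_num) (by positivity) ?_
      rw [mul_pow, mul_pow, Real.sq_sqrt hK'.le, Real.sq_sqrt (by positivity)]
      calc (K : ℝ) * B ^ 2 * (T / B) = K * T * B := by field_simp
        _ ≤ K * T * (2 * β) := by gcongr
        _ = 2 * (a * k * τ ^ 2) ^ 2 := by
          rw [← hk3, ← ht3, hβ]; field_simp
        _ ≤ (3 / 2 * (a * k * τ ^ 2)) ^ 2 := by nlinarith [sq_nonneg (a * k * τ ^ 2)]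
    have e2 : β ≤ a * k * τ ^ 2 := by
      have e : β = a * (a * τ) / k := by rw [hβ]; field_simp
      rw [e, div_le_iff₀ hk0]
      calc a * (a * τ) ≤ a * (k ^ 2 * τ * τ) := by gcongr
        _ = _ := by ring
    have e3 : lam * ((T : ℝ) / B) ≤ a * k * τ ^ 2 := by
      calc lam * ((T : ℝ) / B) ≤ lam * (T / β) := by gcongr
        _ = a * k * τ ^ 2 := by rw [← ha3, ← ht3, hβ]; field_simp
    linarith

theorem reactsOnlyToFinishedBlocks_oblivious {K : ℕ} [NeZero K] (l : ℕ → Loss K) (T : ℕ)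
    (lam : ℝ) : (oblivious l).ReactsOnlyToFinishedBlocks T lam := fun _ _ _ _ _ => rfl

theorem gap_le_one {K : ℕ} {env : Environment K} {istar : Fin K} {Δ : Fin K → ℝ}
    (hs : env.IsStochasticallyConstrained istar Δ) {i : Fin K} (hi : i ≠ istar) : Δ i ≤ 1 := by
  rw [← hs 0 Fin.elim0 i hi]
  have h := norm_integral_le_of_norm_le_const (μ := env.lossKernel 0 Fin.elim0)
    (f := fun l : Loss K => ((l i : ℝ) - l istar)) (C := 1)
    (Filter.Eventually.of_forall fun l => by
      rw [Real.norm_eq_abs, abs_le]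
      constructor <;> linarith [(l i).2.1, (l i).2.2, (l istar).2.1, (l istar).2.2])
  rw [probReal_univ, mul_one] at h
  exact (le_abs_self _).trans h

theorem one_le_log {T : ℕ} (hT : 3 ≤ T) : 1 ≤ Real.log T := by
  rw [Real.le_log_iff_exp_le (by positivity)]
  have : (3 : ℝ) ≤ T := by exact_mod_cast hT
  linarith [Real.exp_one_lt_d9]

/-- The arm `i⋆` attains the minimum in the definition of the pseudo-regret. -/
theorem expectedRegret_le_regretAgainst {K : ℕ} [NeZero K] (T : ℕ) (lam : ℝ) {env : Environment K}
    {istar : Fin K} {Δ : Fin K → ℝ} (hΔ : ∀ i, i ≠ istar → 0 < Δ i)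
    (hs : env.IsStochasticallyConstrained istar Δ) :
    expectedRegret T lam env ≤ regretAgainst T lam env istar := by
  obtain ⟨i₀, hi₀⟩ := exists_expectedRegret_eq T lam env
  rw [hi₀]
  by_cases hne : i₀ = istar
  · rw [hne]
  have hle : ∫ h, cum (armLoss istar) T h ∂(gameLaw T lam env T)
      ≤ ∫ h, cum (armLoss i₀) T h ∂(gameLaw T lam env T) := by
    refine integral_cum_le_of_mean_le T lam env (isBounded_armLoss istar) (isBounded_armLoss i₀)
      (fun t h => Finset.sum_le_sum fun i _ => mul_le_mul_of_nonneg_left ?_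
        ((armProb_mem _).1 i)) T
    have hI : ∀ j : Fin K, Integrable (fun l : Loss K => (l j : ℝ)) (env.lossKernel t h) :=
      fun j => Integrable.of_bound (C := 1)
        (measurable_subtype_coe.comp (measurable_pi_apply j)).aestronglyMeasurable
        (Filter.Eventually.of_forall fun l => by
          rw [Real.norm_of_nonneg (l j).2.1]; exact (l j).2.2)
    have h1 := hs t h i₀ hne
    rw [integral_sub (hI i₀) (hI istar)] at h1
    have h2 := hΔ i₀ hne
    simp only [armLoss]
    linarith
  unfold regretAgainst
  linarith

end SwitchTsallis

open SwitchTsallis in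
theorem theorem1 :
    ∃ C : ℝ, 0 < C ∧ ∀ (K : ℕ) [NeZero K] (T : ℕ) (lam : ℝ), 2 ≤ K → K < T →
      √((K : ℝ) / T) ≤ lam → lam ≤ √(K : ℝ) * T →
      (∀ l : ℕ → SwitchTsallis.Loss K,
        SwitchTsallis.expectedRegret T lam (SwitchTsallis.oblivious l)
          ≤ C * ((lam * K) ^ (1 / 3 : ℝ) * (T : ℝ) ^ (2 / 3 : ℝ))) ∧
      (∀ (env : SwitchTsallis.Environment K) (istar : Fin K) (Δ : Fin K → ℝ),
        (∀ i, i ≠ istar → 0 < Δ i) →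
        env.IsStochasticallyConstrained istar Δ →
        env.ReactsOnlyToFinishedBlocks T lam →
        SwitchTsallis.expectedRegret T lam env
          ≤ C * min
              ((lam * Real.log T / (⨅ i : {i : Fin K // i ≠ istar}, Δ i) + Real.log T)
                * ∑ i with i ≠ istar, 1 / Δ i)
              ((lam * K) ^ (1 / 3 : ℝ) * (T : ℝ) ^ (2 / 3 : ℝ))) := by
  refine ⟨10400, by norm_num, fun K _ T lam hK hKT h1 h2 => ?_⟩
  obtain ⟨hlam, hthr, hlt, hlU, hsq, hent⟩ :=
    parameter_bounds (by omega : 0 < K) (by omega : 0 < T) h1 h2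
  set U := (lam * K) ^ (1 / 3 : ℝ) * (T : ℝ) ^ (2 / 3 : ℝ) with hU
  have hU0 : 0 < U := hlam.trans_le hlU
  have hB : 0 < blockSize K T lam := blockSize_pos (by omega) (by omega) hlam
  have hadv : ∀ env : Environment K, env.ReactsOnlyToFinishedBlocks T lam →
      expectedRegret T lam env ≤ 10400 * U := by
    intro env hr
    obtain ⟨i₀, hi₀⟩ := exists_expectedRegret_eq T lam env
    have h3 := regretAgainst_le_adversarial hlam.le hr hB hthr i₀
    rw [hi₀]
    linarith
  refine ⟨fun l => hadv _ (reactsOnlyToFinishedBlocks_oblivious l T lam),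
    fun env istar Δ hΔ hs hr => ?_⟩
  rw [mul_min_of_nonneg _ _ (by norm_num)]
  refine le_min ?_ (hadv env hr)
  have hnt : Nontrivial (Fin K) := Fin.nontrivial_iff_two_le.2 hK
  obtain ⟨i₁, hi₁⟩ := exists_ne istar
  have hne : Nonempty {i : Fin K // i ≠ istar} := ⟨⟨i₁, hi₁⟩⟩
  set δ := ⨅ i : {i : Fin K // i ≠ istar}, Δ i with hδdef
  obtain ⟨i₂, hi₂⟩ := exists_eq_ciInf_of_finite (f := fun i : {i : Fin K // i ≠ istar} => Δ i)
  have hδ : 0 < δ := by rw [hδdef, ← hi₂]; exact hΔ _ i₂.2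
  have hδ1 : δ ≤ 1 := by rw [hδdef, ← hi₂]; exact gap_le_one hs i₂.2
  have hδle : ∀ i, i ≠ istar → δ ≤ Δ i := fun i hi =>
    ciInf_le (f := fun i : {i : Fin K // i ≠ istar} => Δ i) (Set.finite_range _).bddBelow ⟨i, hi⟩
  set D := ∑ i with i ≠ istar, 1 / Δ i with hD
  have hD1 : 1 ≤ D := by
    have h3 : 1 ≤ 1 / Δ i₁ := by
      rw [one_le_div (hΔ i₁ hi₁)]; exact gap_le_one hs hi₁
    refine h3.trans (Finset.single_le_sum (f := fun i => 1 / Δ i) (fun i hi => ?_)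
      (Finset.mem_filter.2 ⟨Finset.mem_univ i₁, hi₁⟩))
    exact one_div_nonneg.2 (hΔ i (Finset.mem_filter.1 hi).2).le
  have hlog := one_le_log (by omega : 3 ≤ T)
  set ℓ := Real.log T
  have hR : 81 * D * (1 + ℓ) ≤ 162 * (D * ℓ) := by nlinarith
  have hmain := regretAgainst_le_stochastic hlam.le hr hB hthr hδ hδle hs
    (by norm_num : (0 : ℝ) ≤ 31) (by rw [hlt]; exact hent) hR
  refine (expectedRegret_le_regretAgainst T lam hΔ hs).trans (hmain.trans ?_)
  have hDl : 1 ≤ D * ℓ := one_le_mul_of_one_le_of_one_le hD1 hlog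
  have hx : 1 ≤ D * ℓ / δ := by rw [one_le_div hδ]; linarith
  have e1 : 2 * (162 * (D * ℓ)) / δ = 324 * (D * ℓ / δ) := by ring
  have e2 : (lam * ℓ / δ + ℓ) * D = lam * (D * ℓ / δ) + D * ℓ := by ring
  rw [e1, e2]
  have h3 := mul_le_mul_of_nonneg_left hx hlam.le
  linarith
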